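/- **Conventions.** $G$ is a finite group and characters are complex. For a character $\psi$ of $H\le G$ and $x\in G$, $\psi^{x}$ is the character $g\mapsto\psi(xgx^{-1})$ of $x^{-1}Hx$; $\psi^{L}$ is $\psi$ induced to $L\ge H$; $\ker\psi=\{g\in H:\psi(g)=\psi(1)\}$. Let $\mathcal C$ be the class of finite groups $G$ such that every section $H/K$ ($K\unlhd H\le G$) is abelian or contains a noncentral abelian normal subgroup. **Shoda pairs.** A Shoda pair of $G$ is a pair $(H,K)$ with $K\unlhd H\le G$, $H/K$ cyclic, and such that every $g\in G$ with $\{h^{-1}g^{-1}hg : h\in H\}\cap H\subseteq K$ lies in $H$. For $K\unlhd H\le G$ put $\widehat H=\frac1{|H|}\sum_{h\in H}h\in\mathbb QG$; $\varepsilon(H,H)=\widehat H$ and, for $H\ne K$, $\varepsilon(H,K)=\prod_L(\widehat K-\widehat L)$, with $L$ running over the minimal ones among the normal subgroups of $H$ containing $K$ properly; let $e(G,H,K)$ be the sum of the distinct $G$-conjugates of $\varepsilon(H,K)$. For a Shoda pair there is a unique $\alpha_{(G,H,K)}\in\mathbb Q$ such that $\alpha_{(G,H,K)}e(G,H,K)$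 is a primitive central idempotent of $\mathbb QG$, the one realized by $(H,K)$. A set $\mathcal S$ of Shoda pairs of $G$ is complete and irredundant if $(H,K)\mapsto\alpha_{(G,H,K)}e(G,H,K)$ is a bijection from $\mathcal S$ onto the set of all primitive central idempotents of $\mathbb QG$ realized by Shoda pairs of $G$. **The trees $\mathcal G_N$.** Let $N\unlhd G$. An $N$-linear character triple of $G$ is a triple $(H,A,\vartheta)$ with $A\unlhd H\le G$ and $\vartheta$ a linear character of $A$ that is invariant in $H$ and satisfies $\ker\vartheta^{G}=N$. For each such triple fix a normal subgroup $\mathcal A=\mathcal A_{(H,A,\vartheta)}$ of $H$ of maximal order among those that contain $\ker\vartheta$ and are abelian modulo $\ker\vartheta$ (then $A\le\mathcal A$). Let $\widetilde{\mathrm{Lin}}(\mathcal A|\vartheta)$ be the set of linear characters $\varphi$ of $\mathcal A$ with $\varphi_A=\vartheta$ and $\ker\varphi^{G}=N$; the group of automorphisms of $\mathbb C$ fixing $\mathbb Q(\vartheta)$ acts on it by $\varphi\mapsto\sigma\circ\varphi$ and $H$ acts by $\varphi\mapsto\varphi^{h}$. Fix a set $\mathfrak{Lin}(\mathcal A|\vartheta)$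 of representatives of the distinct orbits of the resulting double action. The direct Clifford correspondents of $(H,A,\vartheta)$ are the triples $(I_H(\varphi),\mathcal A,\varphi)$, $\varphi\in\mathfrak{Lin}(\mathcal A|\vartheta)$, where $I_H(\varphi)=\{g\in H:\varphi^{g}=\varphi\}$, if $H\ne A$; there are none if $H=A$. Let $\mathcal G$ be the directed graph on all $N$-linear character triples of $G$ with an edge $(u,v)$ whenever $v$ is a direct Clifford correspondent of $u$, and $\mathcal G_N$ its subgraph induced on the vertices that can be reached from $(G,N,1_N)$ by a directed path (for $G\in\mathcal C$ it is a tree, and this path is unique). Let $\mathcal L_N$ be the set of sinks of $\mathcal G_N$ of the form $(H,H,\vartheta)$, and $\mathcal S_N=\{(H,\ker\vartheta):(H,H,\vartheta)\in\mathcal L_N\}$. A leaf $(H,H,\vartheta)\in\mathcal L_N$ is called good if, with $(H_1,A_1,\vartheta_1)=(G,N,1_N),\dots,(H_n,A_n,\vartheta_n)=(H,H,\vartheta)$ the vertices on the directed path from $(G,N,1_N)$ to it, for all $1<i\le n$ and all $x\in N_{H_{i-1}}(\ker\vartheta_i)$ there is a field automorphism $\sigma$ of $\mathbb C$ with $(\vartheta^{H_i})^{x}=\sigma\circ\vartheta^{H_i}$.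 **Theorem.** Let $G\in\mathcal C$, and let any choices of the subgroups $\mathcal A_{(H,A,\vartheta)}$ and of the sets of representatives as above be fixed. Then $\bigcup_{N\unlhd G}\mathcal S_N$ is a complete and irredundant set of Shoda pairs of $G$ if and only if, for every normal subgroup $N$ of $G$, every leaf in $\mathcal L_N$ is good. -/

import Mathlib

namespace ShodaPairs

/-- The class `𝒞`: finite groups all of whose sections `H ⧸ K` (`K ⊴ H ≤ G`) are either abelian
or contain a noncentral abelian normal subgroup. -/
def InClassC (G : Type*) [Group G] : Prop :=
  ∀ (H : Subgroup G) (K : Subgroup H) [K.Normal],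
    (∀ a b : H ⧸ K, a * b = b * a) ∨
      ∃ B : Subgroup (H ⧸ K), B.Normal ∧ (∀ a ∈ B, ∀ b ∈ B, a * b = b * a) ∧
        ¬ B ≤ Subgroup.center (H ⧸ K)

section Idempotents

variable {G : Type*} [Group G] [Fintype G]

open Classical in
/-- `Ĥ = |H|⁻¹ ∑_{h ∈ H} h` in `ℚG`. -/
noncomputable def hat (H : Subgroup G) : MonoidAlgebra ℚ G :=
  (Nat.card H : ℚ)⁻¹ • ∑ h : G with h ∈ H, MonoidAlgebra.of ℚ G h

/-- `L` is a normal subgroup of `H` that contains `K` properly. -/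
def IsNormalAbove (H K L : Subgroup G) : Prop :=
  K < L ∧ L ≤ H ∧ (L.subgroupOf H).Normal

/-- `L` is minimal among the normal subgroups of `H` that contain `K` properly. -/
def IsMinimalNormalAbove (H K L : Subgroup G) : Prop :=
  IsNormalAbove H K L ∧ ∀ M : Subgroup G, IsNormalAbove H K M → M ≤ L → M = L

open Classical in
noncomputable def minimalNormalsAbove (H K : Subgroup G) : Finset (Subgroup G) :=
  Finset.univ.filter (IsMinimalNormalAbove H K)

theorem of_mul_hat_comm (L : Subgroup G) (g : G) (hg : g ∈ Subgroup.normalizer (L : Set G)) :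
    Commute (MonoidAlgebra.of ℚ G g) (hat L) := by
  classical
  unfold Commute SemiconjBy hat
  rw [mul_smul_comm, smul_mul_assoc, Finset.mul_sum, Finset.sum_mul]
  congr 1
  refine Finset.sum_bij' (fun h _ => g * h * g⁻¹) (fun h _ => g⁻¹ * h * g) ?_ ?_ ?_ ?_ ?_
  · intro h hh
    simp only [Finset.mem_filter, Finset.mem_univ, true_and] at hh ⊢
    exact (Subgroup.mem_normalizer_iff.1 hg h).1 hh
  · intro h hh
    simp only [Finset.mem_filter, Finset.mem_univ, true_and] at hh ⊢
    refine (Subgroup.mem_normalizer_iff.1 hg _).2 ?_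
    simpa [mul_assoc] using hh
  · intro h _
    group
  · intro h _
    group
  · intro h _
    rw [← map_mul, ← map_mul]
    congr 1
    group

theorem hat_mul_hat_comm {H L M : Subgroup G} (hL : L ≤ H) (hM : M ≤ H)
    (hM' : (M.subgroupOf H).Normal) : Commute (hat L) (hat M) := by
  classical
  have hn : H ≤ Subgroup.normalizer (M : Set G) :=
    (Subgroup.normal_subgroupOf_iff_le_normalizer hM).1 hM'
  have : Commute (∑ h : G with h ∈ L, MonoidAlgebra.of ℚ G h) (hat M) := by
    refine Commute.sum_left _ _ _ fun h hh => of_mul_hat_comm M h ?_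
    exact hn (hL (by simpa using hh))
  exact this.smul_left _

theorem hat_mul_hat_comm_of_le {K L : Subgroup G} (h : K ≤ L) : Commute (hat K) (hat L) := by
  refine hat_mul_hat_comm (H := L) h le_rfl ?_
  rw [Subgroup.subgroupOf_self]
  infer_instance

theorem minimalNormalsAbove_commute (H K : Subgroup G) :
    ((minimalNormalsAbove H K : Finset (Subgroup G)) : Set (Subgroup G)).Pairwise
      (Function.onFun Commute fun L => hat K - hat L) := by
  classical
  intro L hL M hM _
  simp only [minimalNormalsAbove, Finset.coe_filter, Finset.mem_univ, true_and,
    Set.mem_ofPred_eq] at hL hM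
  obtain ⟨⟨hKL, hLH, _⟩, _⟩ := hL
  obtain ⟨⟨hKM, hMH, hMn⟩, _⟩ := hM
  have h1 := hat_mul_hat_comm_of_le hKL.le
  have h2 := hat_mul_hat_comm_of_le hKM.le
  have h3 := hat_mul_hat_comm hLH hMH hMn
  exact ((Commute.refl _).sub_right h2).sub_left (h1.symm.sub_right h3)

open Classical in
/-- `ε(H, K)`: it is `K̂` if `H = K`, and otherwise the product of the (commuting) elements
`K̂ - L̂`, where `L` runs over the minimal normal subgroups of `H` containing `K` properly. -/
noncomputable def epsilon (H K : Subgroup G) : MonoidAlgebra ℚ G :=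
  if H = K then hat K
  else (minimalNormalsAbove H K).noncommProd (fun L => hat K - hat L)
    (minimalNormalsAbove_commute H K)

open Classical in
/-- `e(G, H, K)`: the sum of the distinct `G`-conjugates of `ε(H, K)`. -/
noncomputable def conjSum (H K : Subgroup G) : MonoidAlgebra ℚ G :=
  ∑ x ∈ Finset.univ.image (fun g : G =>
    MonoidAlgebra.of ℚ G g⁻¹ * epsilon H K * MonoidAlgebra.of ℚ G g), x

/-- Primitive central idempotents of a ring. -/
def IsPrimitiveCentralIdempotent {R : Type*} [Ring R] (e : R) : Prop :=
  e ∈ Subring.center R ∧ IsIdempotentElem e ∧ e ≠ 0 ∧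
    ∀ f ∈ Subring.center R, ∀ f' ∈ Subring.center R, IsIdempotentElem f → IsIdempotentElem f' →
      f * f' = 0 → e = f + f' → f = 0 ∨ f' = 0

/-- Shoda pairs `(H, K)` of `G`: `K ⊴ H`, `H/K` is cyclic, and every `g ∈ G` such that all the
commutators `[h, g] = h⁻¹ g⁻¹ h g` (`h ∈ H`) which lie in `H` lie in `K` belongs to `H`. -/
def IsShodaPair (p : Subgroup G × Subgroup G) : Prop :=
  p.2 ≤ p.1 ∧ (∃ _ : (p.2.subgroupOf p.1).Normal, IsCyclic (p.1 ⧸ p.2.subgroupOf p.1)) ∧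
    ∀ g : G, (∀ h ∈ p.1, h⁻¹ * g⁻¹ * h * g ∈ p.1 → h⁻¹ * g⁻¹ * h * g ∈ p.2) → g ∈ p.1

open Classical in
/-- The rational number `α_(G,H,K)` for which `α_(G,H,K) e(G, H, K)` is a primitive central
idempotent of `ℚG` (it exists and is unique for a Shoda pair). -/
noncomputable def alpha (p : Subgroup G × Subgroup G) : ℚ :=
  if h : ∃ a : ℚ, IsPrimitiveCentralIdempotent (a • conjSum p.1 p.2) then h.choose else 0

/-- `α_(G,H,K) e(G, H, K)`, the primitive central idempotent realized by the Shoda pair. -/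
noncomputable def realized (p : Subgroup G × Subgroup G) : MonoidAlgebra ℚ G :=
  alpha p • conjSum p.1 p.2

/-- `S` is a complete and irredundant set of Shoda pairs of `G`: it consists of Shoda pairs, and
`(H, K) ↦ α_(G,H,K) e(G, H, K)` maps it bijectively onto the set of all primitive central
idempotents of `ℚG` that are realized by Shoda pairs of `G`. -/
def IsCompleteIrredundant (S : Set (Subgroup G × Subgroup G)) : Prop :=
  (∀ p ∈ S, IsShodaPair p) ∧
    Set.BijOn realized S {e | IsPrimitiveCentralIdempotent e ∧
      ∃ p : Subgroup G × Subgroup G, IsShodaPair p ∧ realized p = e}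

end Idempotents

section Characters

/-! Characters of a subgroup `A` of `G` are regarded as functions on `G` that vanish outside `A`.
With this convention `ϑ ^ x` is the function `g ↦ ϑ (x g x⁻¹)`, which vanishes outside
`x⁻¹ A x`. -/

variable {G : Type*} [Group G]

/-- `ϑ` is a linear (i.e. degree one, complex) character of the subgroup `A`. -/
def IsLinearCharacter (A : Subgroup G) (ϑ : G → ℂ) : Prop :=
  ∃ l : A →* ℂˣ, (∀ a : A, ϑ a = l a) ∧ ∀ g, g ∉ A → ϑ g = 0

/-- `ker χ = {g | χ(g) = χ(1)}`. -/
def charKer (χ : G → ℂ) : Set G := {g | χ g = χ 1}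

open Classical in
/-- The class function `ϑ ^ H` of the subgroup `H ≥ A` induced by the class function `ϑ` of `A`
(it vanishes outside `H`, as `ϑ` vanishes outside `A`). -/
noncomputable def ind [Fintype G] (A H : Subgroup G) (ϑ : G → ℂ) : G → ℂ :=
  fun g => (Nat.card A : ℂ)⁻¹ * ∑ x : G with x ∈ H, ϑ (x * g * x⁻¹)

/-- The inertia group `I_H(φ) = {g ∈ H | φ ^ g = φ}`. -/
def inertia (H : Subgroup G) (φ : G → ℂ) : Subgroup G where
  carrier := {g | g ∈ H ∧ ∀ y, φ (g * y * g⁻¹) = φ y}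
  one_mem' := ⟨H.one_mem, by simp⟩
  mul_mem' := by
    rintro a b ⟨ha, ha'⟩ ⟨hb, hb'⟩
    refine ⟨H.mul_mem ha hb, fun y => ?_⟩
    rw [← hb' y, ← ha' (b * y * b⁻¹)]
    congr 1
    group
  inv_mem' := by
    rintro a ⟨ha, ha'⟩
    refine ⟨H.inv_mem ha, fun y => ?_⟩
    rw [← ha' (a⁻¹ * y * a⁻¹⁻¹)]
    congr 1
    group

/-- Triples `(H, A, ϑ)`. -/
@[ext] structure Triple (G : Type*) [Group G] where
  H : Subgroup G
  A : Subgroup G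
  ϑ : G → ℂ

/-- `(H, A, ϑ)` is a character triple with `ϑ` linear: `A ⊴ H ≤ G`, and the linear character
`ϑ` of `A` is invariant in `H`. -/
def Triple.IsLinear (v : Triple G) : Prop :=
  v.A ≤ v.H ∧ (v.A.subgroupOf v.H).Normal ∧ IsLinearCharacter v.A v.ϑ ∧
    ∀ h ∈ v.H, ∀ g, v.ϑ (h * g * h⁻¹) = v.ϑ g

/-- `(H, A, ϑ)` is an `N`-linear character triple of `G`: moreover, `ker ϑ ^ G = N`. -/
def Triple.IsNLinear [Fintype G] (N : Subgroup G) (v : Triple G) : Prop :=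
  v.IsLinear ∧ charKer (ind v.A ⊤ v.ϑ) = N

/-- `B` is a normal subgroup of `H` containing `ker ϑ` such that `B / ker ϑ` is abelian. -/
def Triple.IsAbelianNormalAbove (v : Triple G) (B : Subgroup G) : Prop :=
  charKer v.ϑ ⊆ B ∧ B ≤ v.H ∧ (B.subgroupOf v.H).Normal ∧
    ∀ a ∈ B, ∀ b ∈ B, a⁻¹ * b⁻¹ * a * b ∈ charKer v.ϑ

/-- For an `N`-linear triple `(H, A, ϑ)`, the set `Lin~(B | ϑ)` of the linear characters `φ` of
`B ≥ A` that lie above `ϑ` (for linear characters: the restriction of `φ` to `A` is `ϑ`) and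
satisfy `ker φ ^ G = N`, where `N = ker ϑ ^ G`. -/
def Triple.linTilde [Fintype G] (v : Triple G) (B : Subgroup G) : Set (G → ℂ) :=
  {φ | IsLinearCharacter B φ ∧ (∀ a ∈ v.A, φ a = v.ϑ a) ∧
    charKer (ind B ⊤ φ) = charKer (ind v.A ⊤ v.ϑ)}

/-- `φ` and `φ'` lie in one orbit of the double action of `Aut(ℂ | ϑ) × H`, where `Aut(ℂ | ϑ)` is
the group of the automorphisms of `ℂ` that fix `ℚ(ϑ)`. -/
def Triple.SameOrbit (v : Triple G) (φ φ' : G → ℂ) : Prop :=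
  ∃ σ : ℂ ≃+* ℂ, (∀ z ∈ IntermediateField.adjoin ℚ (Set.range v.ϑ), σ z = z) ∧
    ∃ h ∈ v.H, ∀ g, φ' g = σ (φ (h * g * h⁻¹))

/-- The choices made in the construction: for each linear character triple `(H, A, ϑ)` (it is
`N`-linear for `N = ker ϑ ^ G`), a normal subgroup `𝒜 = 𝒜_(H, A, ϑ)` of `H` of maximal order
containing `ker ϑ` with `𝒜 / ker ϑ` abelian, and a set of representatives of the distinct
orbits of `Lin~(𝒜 | ϑ)` under the double action. -/
structure Choices (G : Type*) [Group G] [Fintype G] where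
  𝒜 : Triple G → Subgroup G
  reps : Triple G → Set (G → ℂ)
  isAbelianNormalAbove : ∀ v : Triple G, v.IsLinear → v.IsAbelianNormalAbove (𝒜 v)
  card_le : ∀ v : Triple G, v.IsLinear → ∀ B : Subgroup G, v.IsAbelianNormalAbove B →
    Nat.card B ≤ Nat.card (𝒜 v)
  reps_subset : ∀ v : Triple G, v.IsLinear → reps v ⊆ v.linTilde (𝒜 v)
  existsUnique_rep : ∀ v : Triple G, v.IsLinear → ∀ φ ∈ v.linTilde (𝒜 v),
    ∃! ψ, ψ ∈ reps v ∧ v.SameOrbit φ ψ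

namespace Choices

variable [Fintype G] (c : Choices G)

/-- `Cl(H, A, ϑ)`, the set of the direct Clifford correspondents of `(H, A, ϑ)`: it is empty if
`H = A`, and otherwise consists of the triples `(I_H(φ), 𝒜, φ)`, where `φ` runs over the chosen
representatives. -/
def Cl (v : Triple G) : Set (Triple G) :=
  {w | v.H ≠ v.A ∧ ∃ φ ∈ c.reps v, w = ⟨inertia v.H φ, c.𝒜 v, φ⟩}

/-- The edges of the directed graph `𝒢` on the `N`-linear character triples of `G`. -/
def Edge (N : Subgroup G) (u v : Triple G) : Prop :=
  u.IsNLinear N ∧ v.IsNLinear N ∧ v ∈ c.Cl u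

open Classical in
/-- `(G, N, 1_N)`. -/
noncomputable def root (N : Subgroup G) : Triple G :=
  ⟨⊤, N, fun g => if g ∈ N then 1 else 0⟩

/-- `w 0, …, w m` is a directed path in `𝒢` from `(G, N, 1_N)` to `v`; these are the
first, …, `(m + 1)`-st node of `v`. -/
def IsPath (N : Subgroup G) (m : ℕ) (w : Fin (m + 1) → Triple G) (v : Triple G) : Prop :=
  w 0 = root N ∧ w (Fin.last m) = v ∧ Function.Injective w ∧
    ∀ i : Fin m, c.Edge N (w i.castSucc) (w i.succ)

/-- The vertex set `𝒱_N` of the tree `𝒢_N`. -/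
def vertices (N : Subgroup G) : Set (Triple G) :=
  {v | v.IsNLinear N ∧ ∃ m w, c.IsPath N m w v}

/-- The set `ℒ_N` of the leaves (sinks) of `𝒢_N` of the type `(H, H, ϑ)`. -/
def leaves (N : Subgroup G) : Set (Triple G) :=
  {v | v ∈ c.vertices N ∧ (∀ u ∈ c.vertices N, ¬ c.Edge N v u) ∧ v.H = v.A}

/-- The set `𝒮_N` of the pairs `(H, ker ϑ)` with `(H, H, ϑ) ∈ ℒ_N`. -/
def shodaPairs (N : Subgroup G) : Set (Subgroup G × Subgroup G) :=
  {p | ∃ v ∈ c.leaves N, p.1 = v.H ∧ (p.2 : Set G) = charKer v.ϑ}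

/-- The leaf `v = (H, H, ϑ)` is good: if `(H_i, A_i, ϑ_i)` are the nodes on the directed path from
`(G, N, 1_N)` to `v`, then for every `i` after the first and every `x` in the normalizer of
`ker ϑ_i` in `H_{i-1}` there is `σ ∈ Aut(ℂ)` with `(ϑ ^ H_i) ^ x = σ ∘ ϑ ^ H_i`. -/
def IsGood (N : Subgroup G) (v : Triple G) : Prop :=
  ∃ m w, c.IsPath N m w v ∧ ∀ i : Fin m, ∀ x ∈ (w i.castSucc).H,
    x ∈ Subgroup.normalizer (charKer (w i.succ).ϑ) →
      ∃ σ : ℂ ≃+* ℂ, ∀ g,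
        ind v.A (w i.succ).H v.ϑ (x * g * x⁻¹) = σ (ind v.A (w i.succ).H v.ϑ g)

end Choices

end Characters

end ShodaPairs

namespace ShodaPairs

/-! Irreducible characters are replaced throughout by primitive central idempotents ("blocks") of
`ℂH`, all viewed inside `ℂG`. A linear character `ϑ` of `A` gives the block `idem A ϑ`; induction
becomes the normalized trace `trInd`; Galois action, conjugation and lying over become `gal`, `cj`
and a nonzero product. The Clifford correspondence (`IsClifford.isBlock_trInd`,
`IsClifford.isBlock_mul`) says that `trInd` and multiplication by the idempotent of the lower
character are inverse to each other on blocks.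

Shoda's condition on `(H, K)` says that `idem H ϑ`, for `ϑ` with kernel `K`, is orthogonal to its
conjugates outside `H`, that is, `ϑ ^ G` is irreducible (`isShodaPair_iff`). The rational idempotent
realized by the pair is the sum of the Galois orbit of the block of `ϑ ^ G`, so two pairs realize
the same idempotent exactly when their blocks are Galois conjugate (`realized_eq_iff`).

Composing Clifford correspondences along a path shows that every leaf gives a Shoda pair. Conversely
a block whose kernel is `N` can be pushed down the tree of `N` up to Galois conjugacy, since
membership in `𝒞` makes `A` grow strictly at each edge (`Choices.exists_leaf_of_isBlock`). So the
leaves realize all idempotents coming from Shoda pairs unconditionally, and only injectivity of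
`realized` is at stake.

If all leaves are good and two leaves have Galois conjugate blocks, they have the same `N`, and one
descends both paths together: over a common node the next characters lie in one orbit of the double
action, hence coincide by the choice of representatives. The conjugating element normalizes the
kernel, and goodness trades it for a field automorphism, so Galois conjugacy survives to the next
level (`Choices.edge_eq_and_exists_gal`). If instead `realized` is injective, an `x` normalizing the
kernel at a node carries the block of a leaf, up to a Galois twist, to a block over the same node.
That block belongs to some leaf below the node; this leaf realizes the same idempotent, so
injectivity identifies the pairs, and this yields the automorphism demanded by goodness
(`Choices.isGood_of_injOn`). -/

theorem exists_ringEquiv_complex_of_minpoly_eq {x y : ℂ} (hx : IsAlgebraic ℚ x)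
    (hxy : minpoly ℚ x = minpoly ℚ y) : ∃ σ : ℂ ≃+* ℂ, σ x = y := by
  classical
  let K := algebraicClosure ℚ ℂ
  have hy : IsAlgebraic ℚ y := by
    refine IsIntegral.isAlgebraic ?_
    by_contra h
    rw [minpoly.eq_zero h] at hxy
    exact minpoly.ne_zero hx.isIntegral hxy
  let x' : K := ⟨x, mem_algebraicClosure_iff.2 hx⟩
  let y' : K := ⟨y, mem_algebraicClosure_iff.2 hy⟩
  have hconj : IsConjRoot ℚ x' y' := by
    rw [isConjRoot_def, ← minpoly.algebraMap_eq (algebraMap K ℂ).injective x',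
      ← minpoly.algebraMap_eq (algebraMap K ℂ).injective y']
    exact hxy
  have : IsAlgClosure ℚ K := algebraicClosure.isAlgClosure ℚ ℂ
  have : Normal ℚ K := IsAlgClosure.normal ℚ K
  -- The automorphism of the algebraic numbers is extended to `ℂ` in two stages: it acts on the
  -- coefficients of the polynomial ring `R` over a transcendence basis, and then lifts to `ℂ` as
  -- the algebraic closure of `R`.
  obtain ⟨e, he⟩ := hconj.exists_algEquiv
  obtain ⟨s, hs⟩ := exists_isTranscendenceBasis K ℂ
  let R := Algebra.adjoin K (Set.range ((↑) : s → ℂ))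
  have : IsAlgClosure R ℂ := IsAlgClosed.isAlgClosure_of_transcendence_basis _ hs
  let a := hs.1.aevalEquiv
  let θ : R ≃+* R := (a.symm.toRingEquiv.trans
    (MvPolynomial.mapEquiv s e.symm.toRingEquiv)).trans a.toRingEquiv
  have hθ : ∀ z : K, θ (algebraMap K R z) = algebraMap K R (e.symm z) := by
    intro z
    have h1 : a.symm (algebraMap K R z) = MvPolynomial.C z := a.symm.commutes z
    have h2 : a (MvPolynomial.C (e.symm z)) = algebraMap K R (e.symm z) := a.commutes _
    change a (MvPolynomial.map (e.symm.toRingEquiv : K →+* K) (a.symm (algebraMap K R z))) = _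
    rw [h1, MvPolynomial.map_C, ← h2]
    rfl
  refine ⟨IsAlgClosure.equivOfEquiv ℂ ℂ θ, ?_⟩
  have := IsAlgClosure.equivOfEquiv_algebraMap ℂ ℂ θ (algebraMap K R x')
  have he' : e.symm x' = y' := by rw [← he, AlgEquiv.symm_apply_apply]
  rw [hθ, he'] at this
  exact this

theorem exists_ringEquiv_complex_of_isPrimitiveRoot {n : ℕ} (hn : 0 < n) {x y : ℂ}
    (hx : IsPrimitiveRoot x n) (hy : IsPrimitiveRoot y n) : ∃ σ : ℂ ≃+* ℂ, σ x = y := by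
  refine exists_ringEquiv_complex_of_minpoly_eq
    ((hx.isIntegral hn).tower_top (A := ℚ)).isAlgebraic ?_
  rw [← Polynomial.cyclotomic_eq_minpoly_rat hx hn, ← Polynomial.cyclotomic_eq_minpoly_rat hy hn]

/-! ### Blocks of `ℂH` and the Clifford correspondence -/

section GroupAlgebra

variable {G : Type*} [Group G]

section CommRing

variable {k : Type*} [CommRing k]

/-- Conjugation by `x` on the group algebra: `a ↦ x⁻¹ a x`. -/
noncomputable def cj (x : G) : MonoidAlgebra k G ≃ₐ[k] MonoidAlgebra k G :=
  MonoidAlgebra.domCongr k k (MulAut.conj x⁻¹)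

theorem coeff_cj (x : G) (a : MonoidAlgebra k G) (g : G) :
    (cj x a).coeff g = a.coeff (x * g * x⁻¹) := by
  simp [cj, MonoidAlgebra.coeff_domCongr]

theorem coeff_of_mul (g : G) (a : MonoidAlgebra k G) (y : G) :
    (MonoidAlgebra.of k G g * a).coeff y = a.coeff (g⁻¹ * y) := by
  rw [MonoidAlgebra.of_apply, MonoidAlgebra.coeff_single_mul_eq_mul_coeff (g⁻¹ * y), one_mul]
  intro m _
  rw [eq_inv_mul_iff_mul_eq]

theorem coeff_mul_of (g : G) (a : MonoidAlgebra k G) (y : G) :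
    (a * MonoidAlgebra.of k G g).coeff y = a.coeff (y * g⁻¹) := by
  rw [MonoidAlgebra.of_apply, MonoidAlgebra.coeff_mul_single_eq_coeff_mul (y * g⁻¹), mul_one]
  intro m _
  rw [eq_mul_inv_iff_mul_eq]

theorem cj_eq (x : G) (a : MonoidAlgebra k G) :
    cj x a = MonoidAlgebra.of k G x⁻¹ * a * MonoidAlgebra.of k G x := by
  ext y
  rw [coeff_mul_of, coeff_of_mul, coeff_cj, inv_inv, mul_assoc]

theorem cj_cj (x y : G) (a : MonoidAlgebra k G) : cj x (cj y a) = cj (y * x) a := by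
  ext g
  simp only [coeff_cj]
  congr 1
  group

@[simp] theorem cj_one (a : MonoidAlgebra k G) : cj 1 a = a := by
  ext g
  simp [coeff_cj]

theorem of_mul_cj (x : G) (a : MonoidAlgebra k G) :
    MonoidAlgebra.of k G x * cj x a = a * MonoidAlgebra.of k G x := by
  rw [cj_eq, ← mul_assoc, ← mul_assoc, ← map_mul, mul_inv_cancel, map_one, one_mul]

theorem cj_of (x g : G) :
    cj x (MonoidAlgebra.of k G g) = MonoidAlgebra.of k G (x⁻¹ * g * x) := by
  rw [cj_eq, map_mul, map_mul]

theorem eq_sum_coeff [Fintype G] (a : MonoidAlgebra k G) :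
    a = ∑ g, a.coeff g • MonoidAlgebra.of k G g := by
  classical
  ext y
  rw [MonoidAlgebra.coeff_sum, Finsupp.finsetSum_apply, Finset.sum_eq_single y]
  · simp
  · intro b _ hb
    simp [hb]
  · simp

theorem mul_eq_sum_coeff [Fintype G] (a b : MonoidAlgebra k G) :
    a * b = ∑ g, a.coeff g • (MonoidAlgebra.of k G g * b) := by
  conv_lhs => rw [eq_sum_coeff a]
  rw [Finset.sum_mul]
  simp only [smul_mul_assoc]

end CommRing

variable [Fintype G]

/-- The group algebra `ℂH` as a subalgebra of `ℂG`. -/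
noncomputable def supp (H : Subgroup G) : Subalgebra ℂ (MonoidAlgebra ℂ G) where
  carrier := {a | ∀ g, g ∉ H → a.coeff g = 0}
  mul_mem' := by
    intro a b ha hb y hy
    rw [mul_eq_sum_coeff, MonoidAlgebra.coeff_sum, Finsupp.finsetSum_apply]
    refine Finset.sum_eq_zero fun g _ => ?_
    rw [MonoidAlgebra.coeff_smul_apply, coeff_of_mul]
    by_cases hg : g ∈ H
    · rw [hb _ fun h => hy ((H.mul_mem_cancel_left (H.inv_mem hg)).1 h), smul_zero]
    · rw [ha _ hg, zero_smul]
  add_mem' := by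
    intro a b ha hb g hg
    simp [ha g hg, hb g hg]
  algebraMap_mem' := by
    intro r g hg
    have : g ≠ 1 := fun h => hg (h ▸ H.one_mem)
    simp [this.symm]

theorem supp_mono {H K : Subgroup G} (h : H ≤ K) : supp H ≤ supp K :=
  fun _ ha g hg => ha g fun h' => hg (h h')

theorem of_mem_supp {H : Subgroup G} {g : G} (hg : g ∈ H) :
    MonoidAlgebra.of ℂ G g ∈ supp H := by
  intro y hy
  have : g ≠ y := by rintro rfl; exact hy hg
  simp [this]

theorem cj_mem_supp {H : Subgroup G} {x : G} (hx : x ∈ H) {a : MonoidAlgebra ℂ G}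
    (ha : a ∈ supp H) : cj x a ∈ supp H := by
  rw [cj_eq]
  exact mul_mem (mul_mem (of_mem_supp (H.inv_mem hx)) ha) (of_mem_supp hx)

/-- The center of `ℂH`, as a subalgebra of `ℂG`. -/
noncomputable def cen (H : Subgroup G) : Subalgebra ℂ (MonoidAlgebra ℂ G) where
  carrier := {a | a ∈ supp H ∧ ∀ h ∈ H, cj h a = a}
  mul_mem' := by
    rintro a b ⟨ha, ha'⟩ ⟨hb, hb'⟩
    exact ⟨mul_mem ha hb, fun h hh => by rw [map_mul, ha' h hh, hb' h hh]⟩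
  add_mem' := by
    rintro a b ⟨ha, ha'⟩ ⟨hb, hb'⟩
    exact ⟨add_mem ha hb, fun h hh => by rw [map_add, ha' h hh, hb' h hh]⟩
  algebraMap_mem' := fun r => ⟨Subalgebra.algebraMap_mem _ r, fun h _ => AlgEquiv.commutes _ r⟩

theorem cen_commute {H : Subgroup G} {a b : MonoidAlgebra ℂ G} (ha : a ∈ cen H)
    (hb : b ∈ supp H) : a * b = b * a := by
  rw [eq_sum_coeff b, Finset.mul_sum, Finset.sum_mul]
  refine Finset.sum_congr rfl fun g _ => ?_
  by_cases hg : g ∈ H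
  · rw [mul_smul_comm, smul_mul_assoc]
    conv_rhs => rw [← ha.2 g hg]
    rw [of_mul_cj]
  · rw [hb g hg, zero_smul, zero_mul, mul_zero]

/-- Primitive idempotents of the center of `ℂH`. -/
structure IsBlock (H : Subgroup G) (e : MonoidAlgebra ℂ G) : Prop where
  mem : e ∈ cen H
  idem : e * e = e
  ne_zero : e ≠ 0
  prim : ∀ f ∈ cen H, f * f = f → f * e = f → f = 0 ∨ f = e

theorem IsBlock.mul_eq_zero_or {H : Subgroup G} {e z : MonoidAlgebra ℂ G} (he : IsBlock H e)
    (hz : z ∈ cen H) (hzz : z * z = z) : e * z = 0 ∨ e * z = e := by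
  have hc := cen_commute he.mem hz.1
  refine he.prim _ (mul_mem he.mem hz) ?_ ?_
  · rw [mul_assoc, ← mul_assoc z, ← hc, mul_assoc, hzz, ← mul_assoc, he.idem]
  · rw [mul_assoc, ← hc, ← mul_assoc, he.idem]

/-- By primitivity on each side, a nonzero `e * f` equals both `e` and `f`. -/
theorem IsBlock.eq_of_mul_ne_zero {H : Subgroup G} {e f : MonoidAlgebra ℂ G} (he : IsBlock H e)
    (hf : IsBlock H f) (h : e * f ≠ 0) : e = f := by
  have h1 := (he.mul_eq_zero_or hf.mem hf.idem).resolve_left h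
  have h2 := (hf.mul_eq_zero_or he.mem he.idem).resolve_left
    (by rwa [← cen_commute he.mem hf.mem.1])
  rw [← h1, cen_commute he.mem hf.mem.1, h2]

open Classical in
/-- The map `f ↦ |T|⁻¹ ∑_{h ∈ H} h⁻¹ f h`. -/
noncomputable def trInd (T H : Subgroup G) : MonoidAlgebra ℂ G →ₗ[ℂ] MonoidAlgebra ℂ G :=
  (Nat.card T : ℂ)⁻¹ • ∑ x : G with x ∈ H, (cj x).toLinearMap

open Classical in
theorem trInd_apply (T H : Subgroup G) (f : MonoidAlgebra ℂ G) :
    trInd T H f = (Nat.card T : ℂ)⁻¹ • ∑ x : G with x ∈ H, cj x f := by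
  simp [trInd]

theorem natCard_ne_zero (T : Subgroup G) : (Nat.card T : ℂ) ≠ 0 :=
  Nat.cast_ne_zero.2 Nat.card_pos.ne'

open Classical in
theorem card_filter_mem (T : Subgroup G) :
    (Finset.univ.filter (fun x : G => x ∈ T)).card = Nat.card T := by
  rw [Nat.card_eq_fintype_card, Fintype.card_subtype]

theorem cj_trInd {T H : Subgroup G} {h : G} (hh : h ∈ H) (f : MonoidAlgebra ℂ G) :
    cj h (trInd T H f) = trInd T H f := by
  classical
  rw [trInd_apply, map_smul, map_sum]
  congr 1
  refine Finset.sum_bij' (fun x _ => x * h) (fun x _ => x * h⁻¹) ?_ ?_ ?_ ?_ ?_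
  · intro x hx
    simpa [H.mul_mem_cancel_right hh] using hx
  · intro x hx
    simpa [H.mul_mem_cancel_right (H.inv_mem hh)] using hx
  · simp
  · simp
  · intro x _
    rw [cj_cj]

theorem trInd_mem_cen {T H : Subgroup G} (hTH : T ≤ H) {f : MonoidAlgebra ℂ G}
    (hf : f ∈ supp T) : trInd T H f ∈ cen H := by
  classical
  refine ⟨?_, fun h hh => cj_trInd hh f⟩
  rw [trInd_apply]
  refine Subalgebra.smul_mem _ (sum_mem fun x hx => ?_) _
  exact cj_mem_supp (by simpa using hx) (supp_mono hTH hf)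

theorem mul_trInd {T H : Subgroup G} {e : MonoidAlgebra ℂ G} (he : ∀ h ∈ H, cj h e = e)
    (f : MonoidAlgebra ℂ G) : e * trInd T H f = trInd T H (e * f) := by
  classical
  rw [trInd_apply, trInd_apply, mul_smul_comm, Finset.mul_sum]
  congr 1
  refine Finset.sum_congr rfl fun x hx => ?_
  rw [map_mul, he x (by simpa using hx)]

theorem trInd_mul {T H : Subgroup G} {e : MonoidAlgebra ℂ G} (he : ∀ h ∈ H, cj h e = e)
    (f : MonoidAlgebra ℂ G) : trInd T H f * e = trInd T H (f * e) := by
  classical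
  rw [trInd_apply, trInd_apply, smul_mul_assoc, Finset.sum_mul]
  congr 1
  refine Finset.sum_congr rfl fun x hx => ?_
  rw [map_mul, he x (by simpa using hx)]

/-- Transitivity of induction: summing over `H` absorbs each conjugation by an element of `T`, and
the `|T|` repetitions cancel the factor `|T|⁻¹`. -/
theorem trInd_trInd {L T H : Subgroup G} (hTH : T ≤ H) (f : MonoidAlgebra ℂ G) :
    trInd T H (trInd L T f) = trInd L H f := by
  classical
  have key : ∀ t ∈ T, ∑ x : G with x ∈ H, cj x (cj t f) = ∑ x : G with x ∈ H, cj x f := by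
    intro t ht
    have ht' := hTH ht
    refine Finset.sum_bij' (fun x _ => t * x) (fun x _ => t⁻¹ * x) ?_ ?_ ?_ ?_ ?_
    · intro x hx
      simpa [H.mul_mem_cancel_left ht'] using hx
    · intro x hx
      simpa [H.mul_mem_cancel_left (H.inv_mem ht')] using hx
    · simp
    · simp
    · intro x _
      rw [cj_cj]
  rw [trInd_apply, trInd_apply, trInd_apply]
  simp only [map_smul, map_sum]
  rw [← Finset.smul_sum, Finset.sum_comm,
    Finset.sum_congr rfl (fun t ht => key t (by simpa using ht)), Finset.sum_const,
    card_filter_mem, ← Nat.cast_smul_eq_nsmul ℂ, smul_comm, smul_smul, smul_smul, mul_assoc,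
    inv_mul_cancel₀ (natCard_ne_zero T), mul_one]

/-- An idempotent `p` of the center of `ℂT` whose conjugates under `H ≥ T` other than `p` itself
are orthogonal to `p` and which has stabilizer `T` in `H`. -/
structure IsClifford (H T : Subgroup G) (p : MonoidAlgebra ℂ G) : Prop where
  le : T ≤ H
  mem : p ∈ cen T
  idem : p * p = p
  orth : ∀ h ∈ H, h ∉ T → p * cj h p = 0

namespace IsClifford

variable {H T L : Subgroup G} {p q e f : MonoidAlgebra ℂ G}

theorem orth' (hp : IsClifford H T p) {h : G} (hh : h ∈ H) (hT : h ∉ T) : cj h p * p = 0 := by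
  have := congrArg (cj h) (hp.orth h⁻¹ (H.inv_mem hh) fun h' => hT (inv_mem_iff.1 h'))
  rwa [map_mul, cj_cj, inv_mul_cancel, cj_one, map_zero] at this

theorem mul_of_mul (hp : IsClifford H T p) {g : G} (hg : g ∈ H) (hT : g ∉ T) :
    p * MonoidAlgebra.of ℂ G g * p = 0 := by
  rw [← of_mul_cj, mul_assoc, hp.orth' hg hT, mul_zero]

/-- Elements `g` outside `T` contribute nothing, as `p * g * p = 0` by orthogonality of the
conjugates; this is what makes `H`-central elements cut by `p` land in `ℂT`. -/
theorem corner_mem (hp : IsClifford H T p) {a : MonoidAlgebra ℂ G} (ha : a ∈ supp H) :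
    p * a * p ∈ supp T := by
  rw [eq_sum_coeff a, Finset.mul_sum, Finset.sum_mul]
  refine sum_mem fun g _ => ?_
  by_cases hg : g ∈ H
  · rw [mul_smul_comm, smul_mul_assoc]
    refine Subalgebra.smul_mem _ ?_ _
    by_cases hT : g ∈ T
    · exact mul_mem (mul_mem hp.mem.1 (of_mem_supp hT)) hp.mem.1
    · rw [hp.mul_of_mul hg hT]
      exact zero_mem _
  · rw [ha g hg, zero_smul, mul_zero, zero_mul]
    exact zero_mem _

theorem mul_mem_cen (hp : IsClifford H T p) (he : e ∈ cen H) : e * p ∈ cen T := by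
  have hc := cen_commute he (supp_mono hp.le hp.mem.1)
  refine ⟨?_, fun h hh => by rw [map_mul, he.2 h (hp.le hh), hp.mem.2 h hh]⟩
  have := hp.corner_mem he.1
  rwa [← hc, mul_assoc, hp.idem] at this

/-- Multiplication by `p` undoes `trInd`: terms with `x ∉ T` die by orthogonality and the `|T|`
others all equal `f`. -/
theorem trInd_mul_eq (hp : IsClifford H T p) (hf : f ∈ cen T) (hfp : f * p = f) :
    trInd T H f * p = f := by
  classical
  rw [trInd_apply, smul_mul_assoc, Finset.sum_mul]
  have : ∀ x ∈ Finset.univ.filter (fun x : G => x ∈ H), cj x f * p = if x ∈ T then f else 0 := by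
    intro x hx
    split_ifs with hT
    · rw [hf.2 x hT, hfp]
    · rw [← hfp, map_mul, mul_assoc, hp.orth' (by simpa using hx) hT, mul_zero]
  rw [Finset.sum_congr rfl this, ← Finset.sum_filter, Finset.sum_const, Finset.filter_filter]
  have h2 : Finset.univ.filter (fun x : G => x ∈ H ∧ x ∈ T) =
      Finset.univ.filter (fun x : G => x ∈ T) :=
    Finset.filter_congr fun x _ => ⟨fun h => h.2, fun h => ⟨hp.le h, h⟩⟩
  rw [h2, card_filter_mem, ← Nat.cast_smul_eq_nsmul ℂ, smul_smul,
    inv_mul_cancel₀ (natCard_ne_zero T), one_smul]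

theorem trInd_idem (hp : IsClifford H T p) (hf : f ∈ cen T) (hfp : f * p = f)
    (hff : f * f = f) : trInd T H f * trInd T H f = trInd T H f := by
  rw [mul_trInd (fun h hh => cj_trInd hh f)]
  congr 1
  have : p * f = f := by rw [cen_commute hp.mem hf.1, hfp]
  rw [← this, ← mul_assoc, this, hp.trInd_mul_eq hf hfp, hff]

/-- One half of the Clifford correspondence. A central idempotent `z` below the trace is recovered
as the trace of `z * p`, and `z * p` is a central idempotent of `ℂT` below `f`. -/
theorem isBlock_trInd (hp : IsClifford H T p) (hf : IsBlock T f) (hfp : f * p = f) :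
    IsBlock H (trInd T H f) := by
  have hep := hp.trInd_mul_eq hf.mem hfp
  refine ⟨trInd_mem_cen hp.le hf.mem.1, hp.trInd_idem hf.mem hfp hf.idem, ?_, ?_⟩
  · intro h
    rw [h, zero_mul] at hep
    exact hf.ne_zero hep.symm
  · intro z hz hzz hze
    have hpf : p * f = f := by rw [cen_commute hp.mem hf.mem.1, hfp]
    have hc := cen_commute hz (supp_mono hp.le hp.mem.1)
    have hzf : z * f = z * p := by
      conv_lhs => rw [← hep, ← mul_assoc, hze]
    have h1 : z * p = 0 ∨ z * p = f := by
      refine hf.prim _ (hp.mul_mem_cen hz) ?_ ?_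
      · rw [mul_assoc, ← mul_assoc p, ← hc, mul_assoc, hp.idem, ← mul_assoc, hzz]
      · rw [mul_assoc, hpf, hzf]
    have h2 : z = trInd T H (z * p) := by
      rw [← hzf, ← mul_trInd hz.2, hze]
    rcases h1 with h1 | h1
    · left
      rw [h2, h1, map_zero]
    · right
      rw [h2, h1]

/-- The trace of `p` is a central idempotent of `ℂH`, so the block `e` is either killed by it or
lies below it; the first is excluded because `e * p ≠ 0`. -/
theorem trInd_block_mul (hp : IsClifford H T p) (he : IsBlock H e) (hep : e * p ≠ 0) :
    trInd T H (e * p) = e := by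
  have h1 := hp.trInd_idem hp.mem hp.idem hp.idem
  have h2 := he.mul_eq_zero_or (trInd_mem_cen hp.le hp.mem.1) h1
  rw [mul_trInd he.mem.2] at h2
  refine h2.resolve_left fun h => hep ?_
  rw [← mul_trInd he.mem.2] at h
  have := hp.trInd_mul_eq hp.mem hp.idem
  rw [← this, ← mul_assoc, h, zero_mul]

/-- The other half of the Clifford correspondence: the trace of a central idempotent `f` below `e *
p` is a central idempotent below `e`, hence `0` or `e`, and multiplying by `p` recovers `f`. -/
theorem isBlock_mul (hp : IsClifford H T p) (he : IsBlock H e) (hep : e * p ≠ 0) :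
    IsBlock T (e * p) := by
  have hc := cen_commute he.mem (supp_mono hp.le hp.mem.1)
  refine ⟨hp.mul_mem_cen he.mem, ?_, hep, ?_⟩
  · rw [mul_assoc, ← mul_assoc p, ← hc, mul_assoc, hp.idem, ← mul_assoc, he.idem]
  · intro f hf hff hfe
    have hfp : f * p = f := by rw [← hfe, mul_assoc, mul_assoc, hp.idem]
    have hf_e : f * e = f := by
      conv_lhs => rw [← hfp]
      rw [mul_assoc, ← hc, hfe]
    have h1 := he.prim _ (trInd_mem_cen hp.le hf.1) (hp.trInd_idem hf hfp hff)
      (by rw [trInd_mul he.mem.2, hf_e])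
    have h2 := hp.trInd_mul_eq hf hfp
    rcases h1 with h1 | h1
    · left
      rw [← h2, h1, zero_mul]
    · right
      rw [← h2, h1]

theorem trans (hp : IsClifford H T p) (hq : IsClifford T L q) (hqp : q * p = q) :
    IsClifford H L q := by
  refine ⟨hq.le.trans hp.le, hq.mem, hq.idem, fun h hh hL => ?_⟩
  by_cases hT : h ∈ T
  · exact hq.orth h hT hL
  · have : p * q = q := by rw [cen_commute hp.mem (supp_mono hq.le hq.mem.1), hqp]
    calc q * cj h q = (q * p) * cj h (p * q) := by rw [hqp, this]
      _ = q * (p * cj h p) * cj h q := by rw [map_mul]; simp only [mul_assoc]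
      _ = 0 := by rw [hp.orth h hh hT, mul_zero, zero_mul]

end IsClifford

end GroupAlgebra

end ShodaPairs

namespace ShodaPairs

variable {G : Type*} [Group G]

/-! ### Linear characters as functions on `G` -/

namespace IsLinearCharacter

variable {A B : Subgroup G} {ϑ φ : G → ℂ}

theorem map_one (h : IsLinearCharacter A ϑ) : ϑ 1 = 1 := by
  obtain ⟨l, hl, -⟩ := h
  have := hl 1
  simpa using this

theorem eq_zero (h : IsLinearCharacter A ϑ) {g : G} (hg : g ∉ A) : ϑ g = 0 := by
  obtain ⟨l, -, hl⟩ := h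
  exact hl g hg

theorem ne_zero (h : IsLinearCharacter A ϑ) {g : G} (hg : g ∈ A) : ϑ g ≠ 0 := by
  obtain ⟨l, hl, -⟩ := h
  rw [hl ⟨g, hg⟩]
  exact Units.ne_zero _

theorem mul_right (h : IsLinearCharacter A ϑ) (y : G) {a : G} (ha : a ∈ A) :
    ϑ (y * a) = ϑ y * ϑ a := by
  by_cases hy : y ∈ A
  · obtain ⟨l, hl, -⟩ := h
    have h1 := hl (⟨y, hy⟩ * ⟨a, ha⟩)
    rw [_root_.map_mul, Units.val_mul, ← hl, ← hl] at h1
    exact h1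
  · rw [h.eq_zero hy, zero_mul, h.eq_zero fun h' => hy ((A.mul_mem_cancel_right ha).1 h')]

theorem mul_left (h : IsLinearCharacter A ϑ) {a : G} (ha : a ∈ A) (y : G) :
    ϑ (a * y) = ϑ a * ϑ y := by
  by_cases hy : y ∈ A
  · exact h.mul_right a hy
  · rw [h.eq_zero hy, mul_zero, h.eq_zero fun h' => hy ((A.mul_mem_cancel_left ha).1 h')]

theorem map_inv (h : IsLinearCharacter A ϑ) (g : G) : ϑ g⁻¹ = (ϑ g)⁻¹ := by
  by_cases hg : g ∈ A
  · refine eq_inv_of_mul_eq_one_left ?_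
    rw [← h.mul_right _ hg, inv_mul_cancel, h.map_one]
  · rw [h.eq_zero hg, h.eq_zero (fun h' => hg (inv_mem_iff.1 h')), inv_zero]

theorem of_map_mul (h1 : ϑ 1 = 1) (hm : ∀ a ∈ A, ∀ b ∈ A, ϑ (a * b) = ϑ a * ϑ b)
    (h0 : ∀ g, g ∉ A → ϑ g = 0) : IsLinearCharacter A ϑ := by
  let f : A →* ℂ :=
    { toFun := fun a => ϑ a
      map_one' := h1
      map_mul' := fun a b => hm a a.2 b b.2 }
  exact ⟨f.toHomUnits, fun a => rfl, h0⟩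

theorem comp_ringEquiv (h : IsLinearCharacter A ϑ) (σ : ℂ ≃+* ℂ) :
    IsLinearCharacter A (fun g => σ (ϑ g)) := by
  refine of_map_mul ?_ ?_ ?_
  · rw [h.map_one, _root_.map_one]
  · intro a _ b hb
    rw [h.mul_right a hb, map_mul]
  · intro g hg
    rw [h.eq_zero hg, map_zero]

theorem conj_normalizer (h : IsLinearCharacter A ϑ) {x : G}
    (hx : x ∈ Subgroup.normalizer (A : Set G)) :
    IsLinearCharacter A (fun g => ϑ (x * g * x⁻¹)) := by
  have hm := Subgroup.mem_normalizer_iff.1 hx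
  refine of_map_mul ?_ ?_ ?_
  · simp [h.map_one]
  · intro a _ b hb
    rw [← h.mul_right _ ((hm b).1 hb)]
    congr 1
    group
  · intro g hg
    exact h.eq_zero fun h' => hg ((hm g).2 h')

theorem conj_mem (h : IsLinearCharacter A ϑ) {x : G} (hx : x ∈ A) (g : G) :
    ϑ (x * g * x⁻¹) = ϑ g := by
  rw [h.mul_right _ (A.inv_mem hx), h.mul_left hx, h.map_inv, mul_comm (ϑ x), mul_assoc,
    mul_inv_cancel₀ (h.ne_zero hx), mul_one]

theorem mem_charKer (h : IsLinearCharacter A ϑ) {g : G} : g ∈ charKer ϑ ↔ ϑ g = 1 := by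
  rw [charKer, Set.mem_ofPred_eq, h.map_one]

theorem mem_of_mem_charKer (h : IsLinearCharacter A ϑ) {g : G} (hg : g ∈ charKer ϑ) :
    g ∈ A := by
  by_contra hA
  have h1 := h.mem_charKer.1 hg
  rw [h.eq_zero hA] at h1
  exact zero_ne_one h1

/-- The kernel of a linear character, as a subgroup. -/
def ker (h : IsLinearCharacter A ϑ) : Subgroup G where
  carrier := charKer ϑ
  one_mem' := h.mem_charKer.2 h.map_one
  mul_mem' := by
    intro a b ha hb
    rw [h.mem_charKer, h.mul_right a (h.mem_of_mem_charKer hb), h.mem_charKer.1 ha,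
      h.mem_charKer.1 hb, one_mul]
  inv_mem' := by
    intro a ha
    rw [h.mem_charKer, h.map_inv, h.mem_charKer.1 ha, inv_one]

theorem coe_ker (h : IsLinearCharacter A ϑ) : (h.ker : Set G) = charKer ϑ := rfl

theorem mem_ker (h : IsLinearCharacter A ϑ) {g : G} : g ∈ h.ker ↔ ϑ g = 1 := h.mem_charKer

theorem ker_le (h : IsLinearCharacter A ϑ) : h.ker ≤ A := fun _ hg => h.mem_of_mem_charKer hg

theorem ext_of_mem (h : IsLinearCharacter A ϑ) (h' : IsLinearCharacter A φ)
    (he : ∀ a ∈ A, ϑ a = φ a) : ϑ = φ := by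
  funext g
  by_cases hg : g ∈ A
  · exact he g hg
  · rw [h.eq_zero hg, h'.eq_zero hg]

theorem pow_card [Fintype G] (h : IsLinearCharacter A ϑ) {a : G} (ha : a ∈ A) :
    ϑ a ^ Fintype.card G = 1 := by
  obtain ⟨l, hl, -⟩ := h
  rw [hl ⟨a, ha⟩, ← Units.val_pow_eq_pow_val, ← map_pow]
  have : (⟨a, ha⟩ : A) ^ Fintype.card G = 1 := Subtype.ext (by simp)
  rw [this, _root_.map_one, Units.val_one]

theorem norm_le_one [Fintype G] (h : IsLinearCharacter A ϑ) (g : G) : ‖ϑ g‖ ≤ 1 := by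
  by_cases hg : g ∈ A
  · exact (Complex.norm_eq_one_of_pow_eq_one (h.pow_card hg) Fintype.card_ne_zero).le
  · simp [h.eq_zero hg]

theorem map_pow (h : IsLinearCharacter A ϑ) {a : G} (ha : a ∈ A) (n : ℕ) :
    ϑ (a ^ n) = ϑ a ^ n := by
  induction n with
  | zero => simp [h.map_one]
  | succ n ih => rw [pow_succ, pow_succ, h.mul_right _ ha, ih]

/-- Two linear characters of `A` with the same kernel are conjugate under `Aut(ℂ)`. -/
theorem exists_ringEquiv_of_charKer_eq [Fintype G] (h : IsLinearCharacter A ϑ)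
    (h' : IsLinearCharacter A φ) (hk : charKer ϑ = charKer φ) :
    ∃ σ : ℂ ≃+* ℂ, ∀ g, φ g = σ (ϑ g) := by
  have hk' : ∀ g, ϑ g = 1 ↔ φ g = 1 := fun g => by
    rw [← h.mem_charKer, ← h'.mem_charKer, hk]
  obtain ⟨l, hl, -⟩ := id h
  have : Finite l.range := Set.finite_range l
  obtain ⟨⟨_, a, rfl⟩, hgen⟩ := (inferInstance : IsCyclic l.range).exists_zpow_surjective
  have hpow : ∀ b : A, ∃ n : ℕ, ϑ (b : G) = ϑ ((a : G) ^ n) := by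
    intro b
    obtain ⟨n, hn⟩ := mem_powers_iff_mem_zpowers.2 (hgen ⟨l b, b, rfl⟩)
    refine ⟨n, ?_⟩
    have hn' : l a ^ n = l b := by simpa using congrArg Subtype.val hn
    rw [h.map_pow a.2, hl, hl, ← hn', Units.val_pow_eq_pow_val]
  -- The value `ϑ a` generates the cyclic image of `ϑ`. Equal kernels force `ϑ a` and `φ a` to be
  -- roots of unity of the same order, hence Galois conjugate.
  have hprim : ∀ n, ϑ (a : G) ^ n = 1 ↔ φ (a : G) ^ n = 1 := fun n => by
    rw [← h.map_pow a.2, ← h'.map_pow a.2, hk']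
  have h1 := IsPrimitiveRoot.orderOf (ϑ (a : G))
  have h2 : IsPrimitiveRoot (φ (a : G)) (orderOf (ϑ (a : G))) :=
    ⟨(hprim _).1 h1.pow_eq_one, fun l hl => h1.dvd_of_pow_eq_one l ((hprim _).2 hl)⟩
  have hpos : 0 < orderOf (ϑ (a : G)) :=
    orderOf_pos_iff.2 (isOfFinOrder_iff_pow_eq_one.2 ⟨_, Fintype.card_pos, h.pow_card a.2⟩)
  obtain ⟨σ, hσ⟩ := exists_ringEquiv_complex_of_isPrimitiveRoot hpos h1 h2
  refine ⟨σ, fun g => ?_⟩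
  by_cases hg : g ∈ A
  · obtain ⟨n, hn⟩ := hpow ⟨g, hg⟩
    have han := A.pow_mem a.2 n
    -- Modulo the common kernel `g` is a power of `a`, so the automorphism chosen at `a` works at
    -- `g`.
    have h3 : ϑ (g * ((a : G) ^ n)⁻¹) = 1 := by
      rw [h.mul_right _ (A.inv_mem han), h.map_inv, hn, mul_inv_cancel₀ (h.ne_zero han)]
    rw [hk', h'.mul_right _ (A.inv_mem han), h'.map_inv,
      mul_inv_eq_one₀ (h'.ne_zero han)] at h3
    rw [h3, hn, h.map_pow a.2, h'.map_pow a.2, _root_.map_pow, hσ]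
  · rw [h.eq_zero hg, h'.eq_zero hg, map_zero]

theorem finite [Fintype G] (A : Subgroup G) : {ϑ : G → ℂ | IsLinearCharacter A ϑ}.Finite := by
  have hfin : ({0} ∪ {z : ℂ | z ^ Fintype.card G = 1}).Finite := by
    refine (Set.finite_singleton 0).union ?_
    refine (Finset.finite_toSet (Polynomial.nthRootsFinset (Fintype.card G) (1 : ℂ))).subset ?_
    intro z hz
    exact (Polynomial.mem_nthRootsFinset Fintype.card_pos _).2 hz
  refine (Set.Finite.pi' fun _ : G => hfin).subset fun ϑ h g => ?_
  by_cases hg : g ∈ A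
  · exact Or.inr (h.pow_card hg)
  · exact Or.inl (h.eq_zero hg)

end IsLinearCharacter

/-! ### Idempotents of linear characters -/

section Idem

variable [Fintype G]

/-- The idempotent `|A|⁻¹ ∑_a ϑ(a⁻¹) a` attached to a linear character `ϑ` of `A`. -/
noncomputable def idem (A : Subgroup G) (ϑ : G → ℂ) : MonoidAlgebra ℂ G :=
  .ofCoeff (Finsupp.equivFunOnFinite.symm fun g => (Nat.card A : ℂ)⁻¹ * ϑ g⁻¹)

theorem coeff_idem (A : Subgroup G) (ϑ : G → ℂ) (g : G) :
    (idem A ϑ).coeff g = (Nat.card A : ℂ)⁻¹ * ϑ g⁻¹ := rfl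

variable {A B H : Subgroup G} {ϑ φ : G → ℂ}

theorem cj_idem (x : G) : cj x (idem A ϑ) = idem A (fun g => ϑ (x * g * x⁻¹)) := by
  ext g
  rw [coeff_cj, coeff_idem, coeff_idem]
  congr 2
  group

theorem idem_mem_supp (h : IsLinearCharacter A ϑ) : idem A ϑ ∈ supp A := by
  intro g hg
  rw [coeff_idem, h.eq_zero fun h' => hg (inv_mem_iff.1 h'), mul_zero]

theorem idem_ne_zero (h : IsLinearCharacter A ϑ) : idem A ϑ ≠ 0 := by
  intro h0
  have h1 : (idem A ϑ).coeff 1 = 0 := by rw [h0]; rfl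
  rw [coeff_idem, inv_one, h.map_one, mul_one] at h1
  exact inv_ne_zero (natCard_ne_zero A) h1

theorem of_mul_idem (h : IsLinearCharacter A ϑ) {a : G} (ha : a ∈ A) :
    MonoidAlgebra.of ℂ G a * idem A ϑ = ϑ a • idem A ϑ := by
  ext y
  rw [coeff_of_mul, MonoidAlgebra.coeff_smul_apply, coeff_idem, coeff_idem, mul_inv_rev, inv_inv,
    h.mul_right _ ha, smul_eq_mul]
  ring

theorem idem_mul_of (h : IsLinearCharacter A ϑ) {a : G} (ha : a ∈ A) :
    idem A ϑ * MonoidAlgebra.of ℂ G a = ϑ a • idem A ϑ := by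
  ext y
  rw [coeff_mul_of, MonoidAlgebra.coeff_smul_apply, coeff_idem, coeff_idem, mul_inv_rev, inv_inv,
    h.mul_left ha, smul_eq_mul]
  ring

theorem idem_mem_cen (h : IsLinearCharacter A ϑ) : idem A ϑ ∈ cen A := by
  refine ⟨idem_mem_supp h, fun x hx => ?_⟩
  rw [cj_idem]
  congr 1
  funext g
  exact h.conj_mem hx g

theorem idem_mul_eq_self (h : IsLinearCharacter A ϑ) {x : MonoidAlgebra ℂ G}
    (hx : ∀ a ∈ A, MonoidAlgebra.of ℂ G a * x = ϑ a • x) : idem A ϑ * x = x := by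
  classical
  rw [mul_eq_sum_coeff]
  have : ∀ g, (idem A ϑ).coeff g • (MonoidAlgebra.of ℂ G g * x) =
      if g ∈ A then (Nat.card A : ℂ)⁻¹ • x else 0 := by
    intro g
    split_ifs with hg
    · rw [hx g hg, smul_smul, coeff_idem, h.map_inv, mul_assoc, inv_mul_cancel₀ (h.ne_zero hg),
        mul_one]
    · rw [idem_mem_supp h g hg, zero_smul]
  rw [Finset.sum_congr rfl fun g _ => this g, ← Finset.sum_filter, Finset.sum_const,
    card_filter_mem, ← Nat.cast_smul_eq_nsmul ℂ, smul_smul, mul_inv_cancel₀ (natCard_ne_zero A),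
    one_smul]

theorem idem_mul_eq_zero (h : IsLinearCharacter A ϑ) {x : MonoidAlgebra ℂ G} {a : G} (ha : a ∈ A)
    {c : ℂ} (hx : MonoidAlgebra.of ℂ G a * x = c • x) (hc : c ≠ ϑ a) : idem A ϑ * x = 0 := by
  have h1 : ϑ a • (idem A ϑ * x) = c • (idem A ϑ * x) := by
    rw [← smul_mul_assoc, ← idem_mul_of h ha, mul_assoc, hx, mul_smul_comm]
  rw [← sub_eq_zero, ← sub_smul, smul_eq_zero, sub_eq_zero] at h1
  exact h1.resolve_left (Ne.symm hc)

theorem idem_mul_idem (h : IsLinearCharacter A ϑ) : idem A ϑ * idem A ϑ = idem A ϑ :=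
  idem_mul_eq_self h fun _ ha => of_mul_idem h ha

theorem idem_mul_idem_of_ne (h : IsLinearCharacter A ϑ) (h' : IsLinearCharacter A φ)
    (hne : ϑ ≠ φ) : idem A ϑ * idem A φ = 0 := by
  by_contra h0
  refine hne (h.ext_of_mem h' fun a ha => ?_)
  by_contra hc
  exact h0 (idem_mul_eq_zero h ha (of_mul_idem h' ha) (Ne.symm hc))

theorem idem_mul_idem_of_le (h : IsLinearCharacter A ϑ) (h' : IsLinearCharacter B φ)
    (hAB : A ≤ B) (hr : ∀ a ∈ A, φ a = ϑ a) : idem A ϑ * idem B φ = idem B φ :=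
  idem_mul_eq_self h fun a ha => by rw [of_mul_idem h' (hAB ha), hr a ha]

theorem idem_mul_idem_of_not_le (h : IsLinearCharacter A ϑ) (h' : IsLinearCharacter B φ)
    (hAB : A ≤ B) (hr : ¬ ∀ a ∈ A, φ a = ϑ a) : idem A ϑ * idem B φ = 0 := by
  push Not at hr
  obtain ⟨a, ha, hne⟩ := hr
  exact idem_mul_eq_zero h ha (of_mul_idem h' (hAB ha)) hne

theorem idem_mul_mem_supp (h : IsLinearCharacter A ϑ) {a : MonoidAlgebra ℂ G} (ha : a ∈ supp A) :
    ∃ c : ℂ, a * idem A ϑ = c • idem A ϑ := by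
  refine ⟨∑ g, a.coeff g * ϑ g, ?_⟩
  rw [mul_eq_sum_coeff, Finset.sum_smul]
  refine Finset.sum_congr rfl fun g _ => ?_
  by_cases hg : g ∈ A
  · rw [of_mul_idem h hg, smul_smul]
  · rw [ha g hg, zero_smul, zero_mul, zero_smul]

/-- The ideal `ℂA * idem A ϑ` is one-dimensional, so an idempotent in it is a scalar multiple with
scalar `0` or `1`. -/
theorem isBlock_idem (h : IsLinearCharacter A ϑ) : IsBlock A (idem A ϑ) := by
  refine ⟨idem_mem_cen h, idem_mul_idem h, idem_ne_zero h, fun f hf hff hfe => ?_⟩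
  obtain ⟨c, hc⟩ := idem_mul_mem_supp h hf.1
  rw [hfe] at hc
  have h1 : c • idem A ϑ = (c * c) • idem A ϑ := by
    have := hff
    rw [hc, smul_mul_smul_comm, idem_mul_idem h] at this
    exact this.symm
  have h2 : c * c = c := (smul_left_injective ℂ (idem_ne_zero h) h1).symm
  rcases IsIdempotentElem.iff_eq_zero_or_one.1 h2 with h3 | h3
  · left; rw [hc, h3, zero_smul]
  · right; rw [hc, h3, one_smul]

omit [Fintype G] in
theorem le_inertia (h : IsLinearCharacter B φ) (hBH : B ≤ H) : B ≤ inertia H φ :=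
  fun _ hb => ⟨hBH hb, h.conj_mem hb⟩

omit [Fintype G] in
theorem inertia_le (H : Subgroup G) (φ : G → ℂ) : inertia H φ ≤ H := fun _ h => h.1

/-- Conjugates of the idempotent belong to conjugates of `φ`, and idempotents of distinct linear
characters of `B` are orthogonal; so the stabilizer is the inertia group. -/
theorem isClifford_idem (h : IsLinearCharacter B φ) (hBH : B ≤ H)
    (hn : H ≤ Subgroup.normalizer (B : Set G)) : IsClifford H (inertia H φ) (idem B φ) := by
  refine ⟨inertia_le H φ, ⟨supp_mono (le_inertia h hBH) (idem_mem_supp h), fun x hx => ?_⟩,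
    idem_mul_idem h, fun x hx hxT => ?_⟩
  · rw [cj_idem]
    congr 1
    funext g
    exact hx.2 g
  · rw [cj_idem]
    refine idem_mul_idem_of_ne h (h.conj_normalizer (hn hx)) fun he => hxT ⟨hx, fun g => ?_⟩
    exact (congrFun he g).symm

open Classical in
/-- The trivial character of `K`. -/
noncomputable def triv (K : Subgroup G) : G → ℂ := fun g => if g ∈ K then 1 else 0

omit [Fintype G] in
theorem triv_apply_mem {K : Subgroup G} {g : G} (hg : g ∈ K) : triv K g = 1 := if_pos hg

omit [Fintype G] in
theorem isLinearCharacter_triv (K : Subgroup G) : IsLinearCharacter K (triv K) := by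
  refine .of_map_mul (triv_apply_mem K.one_mem) ?_ fun g hg => if_neg hg
  intro a ha b hb
  rw [triv_apply_mem ha, triv_apply_mem hb, triv_apply_mem (mul_mem ha hb), one_mul]

omit [Fintype G] in
theorem charKer_triv (K : Subgroup G) : charKer (triv K) = K := by
  ext g
  rw [(isLinearCharacter_triv K).mem_charKer, triv]
  simp

/-- The finite set of linear characters of `B`. -/
noncomputable def linChars (B : Subgroup G) : Finset (G → ℂ) :=
  (IsLinearCharacter.finite B).toFinset

theorem mem_linChars : φ ∈ linChars B ↔ IsLinearCharacter B φ := by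
  simp [linChars]

/-- Characters of the finite abelian group `B ⧸ K.subgroupOf B` separate points. -/
theorem exists_linearCharacter_apply_ne_one {K : Subgroup G} (hK : (K.subgroupOf B).Normal)
    (hc : ∀ a ∈ B, ∀ b ∈ B, a⁻¹ * b⁻¹ * a * b ∈ K) {g : G} (hg : g ∈ B) (hgK : g ∉ K) :
    ∃ ψ, IsLinearCharacter B ψ ∧ (∀ k ∈ K, k ∈ B → ψ k = 1) ∧ ψ g ≠ 1 := by
  classical
  let Q := B ⧸ K.subgroupOf B
  let : CommGroup Q :=
    { (inferInstance : Group Q) with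
      mul_comm := by
        intro a b
        induction a using QuotientGroup.induction_on with | _ a => ?_
        induction b using QuotientGroup.induction_on with | _ b => ?_
        rw [← QuotientGroup.mk_mul, ← QuotientGroup.mk_mul, QuotientGroup.eq,
          Subgroup.mem_subgroupOf]
        have := hc b b.2 a a.2
        simpa [mul_assoc] using this }
  have hne : (QuotientGroup.mk ⟨g, hg⟩ : Q) ≠ 1 := by
    intro h
    exact hgK (Subgroup.mem_subgroupOf.1 ((QuotientGroup.eq_one_iff _).1 h))
  obtain ⟨f, hf⟩ := CommGroup.exists_apply_ne_one_of_hasEnoughRootsOfUnity Q ℂ hne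
  let l : B →* ℂˣ := f.comp (QuotientGroup.mk' (K.subgroupOf B))
  refine ⟨fun x => if hx : x ∈ B then (l ⟨x, hx⟩ : ℂ) else 0,
    ⟨l, fun a => ?_, fun x hx => ?_⟩, fun k hk hkB => ?_, ?_⟩
  · simp
  · simp [hx]
  · have : (QuotientGroup.mk ⟨k, hkB⟩ : Q) = 1 :=
      (QuotientGroup.eq_one_iff _).2 (Subgroup.mem_subgroupOf.2 hk)
    have h1 : l ⟨k, hkB⟩ = 1 := (congrArg f this).trans f.map_one
    simp [hkB, h1]
  · simp only [hg, dite_true]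
    intro h
    exact hf (Units.ext h)

open Classical in
theorem sum_idem_eq_idem_triv {K : Subgroup G} (hKB : K ≤ B) (hK : (K.subgroupOf B).Normal)
    (hc : ∀ a ∈ B, ∀ b ∈ B, a⁻¹ * b⁻¹ * a * b ∈ K) :
    ∑ φ ∈ linChars B with ∀ k ∈ K, φ k = 1, idem B φ = idem K (triv K) := by
  set E := (linChars B).filter (fun φ => ∀ k ∈ K, φ k = 1) with hE
  have hEmem : ∀ φ, φ ∈ E ↔ IsLinearCharacter B φ ∧ ∀ k ∈ K, φ k = 1 := by
    intro φ
    rw [hE, Finset.mem_filter, mem_linChars]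
  set S := ∑ φ ∈ E, idem B φ with hS
  have htriv := isLinearCharacter_triv K
  have hSS : S * S = S := by
    rw [hS, Finset.sum_mul]
    refine Finset.sum_congr rfl fun φ hφ => ?_
    rw [Finset.mul_sum, Finset.sum_eq_single φ]
    · exact idem_mul_idem ((hEmem φ).1 hφ).1
    · intro ψ hψ hne
      exact idem_mul_idem_of_ne ((hEmem φ).1 hφ).1 ((hEmem ψ).1 hψ).1 hne.symm
    · exact fun h => absurd hφ h
  have hcoef : ∀ g, S.coeff g = (Nat.card B : ℂ)⁻¹ * ∑ φ ∈ E, φ g⁻¹ := by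
    intro g
    rw [hS, MonoidAlgebra.coeff_sum, Finsupp.finsetSum_apply, Finset.mul_sum]
    rfl
  -- Orthogonality relation: for `g ∈ B` outside `K`, multiplication by a `ψ` with `ψ g ≠ 1`
  -- permutes `E`, so the sum is fixed by the factor `ψ g` and vanishes.
  have hsum : ∀ g, ∑ φ ∈ E, φ g = (E.card : ℂ) * triv K g := by
    intro g
    by_cases hg : g ∈ K
    · rw [triv_apply_mem hg, Finset.sum_congr rfl fun φ hφ => ((hEmem φ).1 hφ).2 g hg]
      simp
    rw [htriv.eq_zero hg, mul_zero]
    by_cases hgB : g ∈ B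
    · obtain ⟨ψ, hψ, hψK, hψg⟩ := exists_linearCharacter_apply_ne_one hK hc hgB hg
      have h1 : ∑ φ ∈ E, φ g = ∑ φ ∈ E, ψ g * φ g := by
        refine Finset.sum_bij' (fun φ _ => fun x => ψ x⁻¹ * φ x) (fun φ _ => fun x => ψ x * φ x)
          ?_ ?_ ?_ ?_ ?_
        · intro φ hφ
          obtain ⟨h1, h2⟩ := (hEmem φ).1 hφ
          refine (hEmem _).2 ⟨.of_map_mul ?_ ?_ ?_, fun k hk => ?_⟩
          · simp [hψ.map_one, h1.map_one]
          · intro a ha b hb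
            rw [mul_inv_rev, hψ.mul_right _ (B.inv_mem ha), h1.mul_right _ hb]
            ring
          · intro x hx
            rw [h1.eq_zero hx, mul_zero]
          · rw [h2 k hk, hψ.map_inv, hψK k hk (hKB hk), inv_one, one_mul]
        · intro φ hφ
          obtain ⟨h1, h2⟩ := (hEmem φ).1 hφ
          refine (hEmem _).2 ⟨.of_map_mul ?_ ?_ ?_, fun k hk => ?_⟩
          · simp [hψ.map_one, h1.map_one]
          · intro a ha b hb
            rw [hψ.mul_right _ hb, h1.mul_right _ hb]
            ring
          · intro x hx
            rw [h1.eq_zero hx, mul_zero]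
          · rw [h2 k hk, hψK k hk (hKB hk), one_mul]
        · intro φ hφ
          funext x
          by_cases hx : x ∈ B
          · change ψ x * (ψ x⁻¹ * φ x) = φ x
            rw [hψ.map_inv, ← mul_assoc, mul_inv_cancel₀ (hψ.ne_zero hx), one_mul]
          · simp [((hEmem φ).1 hφ).1.eq_zero hx]
        · intro φ hφ
          funext x
          by_cases hx : x ∈ B
          · change ψ x⁻¹ * (ψ x * φ x) = φ x
            rw [hψ.map_inv, ← mul_assoc, inv_mul_cancel₀ (hψ.ne_zero hx), one_mul]
          · simp [((hEmem φ).1 hφ).1.eq_zero hx]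
        · intro φ hφ
          change φ g = ψ g * (ψ g⁻¹ * φ g)
          rw [hψ.map_inv, ← mul_assoc, mul_inv_cancel₀ (hψ.ne_zero hgB), one_mul]
      rw [← Finset.mul_sum] at h1
      have h2 : (ψ g - 1) * ∑ φ ∈ E, φ g = 0 := by rw [sub_mul, ← h1, one_mul, sub_self]
      exact (mul_eq_zero.1 h2).resolve_left (sub_ne_zero.2 hψg)
    · exact Finset.sum_eq_zero fun φ hφ => ((hEmem φ).1 hφ).1.eq_zero hgB
  have hne : (E.card : ℂ) ≠ 0 := by
    refine Nat.cast_ne_zero.2 (Finset.card_ne_zero_of_mem (a := triv B) ?_)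
    exact (hEmem _).2 ⟨isLinearCharacter_triv B, fun k hk => triv_apply_mem (hKB hk)⟩
  -- The cardinality of `E` need not be known: both sides are idempotent and the scalar is nonzero,
  -- so it is `1`.
  have hScal : S = ((Nat.card B : ℂ)⁻¹ * E.card * Nat.card K) • idem K (triv K) := by
    ext g
    rw [hcoef, hsum, MonoidAlgebra.coeff_smul_apply, coeff_idem, smul_eq_mul, mul_assoc, mul_assoc,
      ← mul_assoc (Nat.card K : ℂ), mul_inv_cancel₀ (natCard_ne_zero K), one_mul]
  set c := (Nat.card B : ℂ)⁻¹ * E.card * Nat.card K with hcdef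
  have hc0 : c ≠ 0 := mul_ne_zero (mul_ne_zero (inv_ne_zero (natCard_ne_zero B)) hne)
    (natCard_ne_zero K)
  rw [hScal, smul_mul_smul_comm, idem_mul_idem htriv] at hSS
  have h2 : c * c = c := smul_left_injective ℂ (idem_ne_zero htriv) hSS
  rw [hScal, (IsIdempotentElem.iff_eq_zero_or_one.1 h2).resolve_left hc0, one_smul]

open Classical in
/-- If `B` is abelian modulo `ker ϑ`, then the idempotent of `ϑ` is the sum of the idempotents of
the extensions of `ϑ` to `B`. -/
theorem idem_eq_sum_extensions (h : IsLinearCharacter A ϑ) (hAB : A ≤ B)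
    (hK : (h.ker.subgroupOf B).Normal)
    (hc : ∀ a ∈ B, ∀ b ∈ B, a⁻¹ * b⁻¹ * a * b ∈ charKer ϑ) :
    idem A ϑ = ∑ φ ∈ linChars B with ∀ a ∈ A, φ a = ϑ a, idem B φ := by
  -- Multiplying the decomposition for `ker ϑ` by `idem A ϑ` keeps exactly the characters that
  -- extend `ϑ`.
  have h1 := sum_idem_eq_idem_triv (h.ker_le.trans hAB) hK hc
  have h2 : idem h.ker (triv h.ker) * idem A ϑ = idem A ϑ :=
    idem_mul_idem_of_le (isLinearCharacter_triv _) h h.ker_le fun k hk => by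
      rw [triv_apply_mem hk, h.mem_ker.1 hk]
  have h3 : idem A ϑ * idem h.ker (triv h.ker) = idem A ϑ := by
    rw [cen_commute (idem_mem_cen h) (supp_mono h.ker_le (idem_mem_supp
      (isLinearCharacter_triv _))), h2]
  rw [← h1, Finset.mul_sum] at h3
  conv_lhs => rw [← h3]
  rw [Finset.sum_filter, Finset.sum_filter]
  refine Finset.sum_congr rfl fun φ hφ => ?_
  rw [mem_linChars] at hφ
  by_cases hr : ∀ a ∈ A, φ a = ϑ a
  · rw [if_pos hr, if_pos fun k hk => ?_, idem_mul_idem_of_le h hφ hAB hr]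
    rw [hr k (h.ker_le hk), h.mem_ker.1 hk]
  · rw [if_neg hr, idem_mul_idem_of_not_le h hφ hAB hr, ite_self]

end Idem

/-! ### Field automorphisms acting on `ℂG` -/

section Galois

variable [Fintype G]

/-- The action of a field automorphism of `ℂ` on the coefficients of `ℂG`. -/
noncomputable def gal (σ : ℂ ≃+* ℂ) : MonoidAlgebra ℂ G ≃+* MonoidAlgebra ℂ G :=
  MonoidAlgebra.mapRingEquiv G σ

variable {A H T : Subgroup G} {ϑ φ : G → ℂ} (σ : ℂ ≃+* ℂ)

omit [Fintype G] in
theorem coeff_gal (a : MonoidAlgebra ℂ G) (g : G) : (gal σ a).coeff g = σ (a.coeff g) := by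
  simp [gal, MonoidAlgebra.coeff_mapRingEquiv]

omit [Fintype G] in
theorem gal_cj (x : G) (a : MonoidAlgebra ℂ G) : gal σ (cj x a) = cj x (gal σ a) := by
  ext g
  simp only [coeff_cj, coeff_gal]

omit [Fintype G] in
theorem gal_of (g : G) : gal σ (MonoidAlgebra.of ℂ G g) = MonoidAlgebra.of ℂ G g := by
  simp [gal]

omit [Fintype G] in
theorem gal_smul (c : ℂ) (a : MonoidAlgebra ℂ G) : gal σ (c • a) = σ c • gal σ a := by
  ext g
  simp [coeff_gal]

omit [Fintype G] in
theorem gal_symm_gal (a : MonoidAlgebra ℂ G) : gal σ.symm (gal σ a) = a := by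
  ext g
  simp only [coeff_gal, RingEquiv.symm_apply_apply]

omit [Fintype G] in
theorem gal_gal (τ : ℂ ≃+* ℂ) (a : MonoidAlgebra ℂ G) :
    gal τ (gal σ a) = gal (σ.trans τ) a := by
  ext g
  simp only [coeff_gal, RingEquiv.trans_apply]

omit [Fintype G] in
theorem gal_refl (a : MonoidAlgebra ℂ G) : gal (RingEquiv.refl ℂ) a = a := by
  ext g
  simp only [coeff_gal, RingEquiv.refl_apply]

theorem gal_trInd (f : MonoidAlgebra ℂ G) : gal σ (trInd T H f) = trInd T H (gal σ f) := by
  classical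
  rw [trInd_apply, trInd_apply, gal_smul, map_sum, map_inv₀, map_natCast]
  simp only [gal_cj]

theorem gal_idem : gal σ (idem A ϑ) = idem A (fun g => σ (ϑ g)) := by
  ext g
  simp [coeff_gal, coeff_idem]

theorem gal_mem_cen {a : MonoidAlgebra ℂ G} (ha : a ∈ cen H) : gal σ a ∈ cen H := by
  refine ⟨fun g hg => ?_, fun h hh => ?_⟩
  · rw [coeff_gal, ha.1 g hg, map_zero]
  · rw [← gal_cj, ha.2 h hh]

theorem IsBlock.gal {e : MonoidAlgebra ℂ G} (he : IsBlock H e) (σ : ℂ ≃+* ℂ) :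
    IsBlock H (gal σ e) := by
  refine ⟨gal_mem_cen σ he.mem, ?_, ?_, fun f hf hff hfe => ?_⟩
  · rw [← map_mul, he.idem]
  · rw [Ne, map_eq_zero_iff _ (RingEquiv.injective _)]
    exact he.ne_zero
  · have h1 := he.prim (ShodaPairs.gal σ.symm f) (gal_mem_cen _ hf) (by rw [← map_mul, hff]) (by
      conv_lhs => rw [← gal_symm_gal σ e]
      rw [← map_mul, hfe])
    have h2 : ShodaPairs.gal σ (ShodaPairs.gal σ.symm f) = f := gal_symm_gal σ.symm f
    rcases h1 with h1 | h1
    · left; rw [← h2, h1, map_zero]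
    · right; rw [← h2, h1]

end Galois

/-! ### Kernels of induced characters, read off from idempotents -/

section Fixer

variable [Fintype G] {A H T : Subgroup G} {ϑ φ : G → ℂ}

/-- The elements of `G` that fix all conjugates of `e` by left multiplication. -/
def fixer (e : MonoidAlgebra ℂ G) : Set G :=
  {g | ∀ x : G, MonoidAlgebra.of ℂ G g * cj x e = cj x e}

omit [Fintype G] in
theorem fixer_gal (σ : ℂ ≃+* ℂ) (e : MonoidAlgebra ℂ G) : fixer (gal σ e) = fixer e := by
  have key : ∀ (σ : ℂ ≃+* ℂ) (e : MonoidAlgebra ℂ G), fixer e ⊆ fixer (gal σ e) := by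
    intro σ e g hg x
    rw [← gal_cj, ← gal_of σ, ← map_mul, hg x]
  refine Set.Subset.antisymm ?_ (key σ e)
  conv_rhs => rw [← gal_symm_gal σ e]
  exact key _ _

omit [Fintype G] in
theorem fixer_cj (y : G) (e : MonoidAlgebra ℂ G) : fixer (cj y e) = fixer e := by
  ext g
  refine ⟨fun h x => ?_, fun h x => ?_⟩
  · have := h (y⁻¹ * x)
    rwa [cj_cj, mul_inv_cancel_left] at this
  · rw [cj_cj]
    exact h _

omit [Fintype G] in
theorem fixer_subset_mul (e f : MonoidAlgebra ℂ G) : fixer e ⊆ fixer (e * f) := by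
  intro g hg x
  rw [map_mul, ← mul_assoc, hg x]

theorem fixer_subset_trInd (f : MonoidAlgebra ℂ G) : fixer f ⊆ fixer (trInd T H f) := by
  classical
  intro g hg x
  rw [trInd_apply, map_smul, map_sum, mul_smul_comm, Finset.mul_sum]
  congr 1
  refine Finset.sum_congr rfl fun y _ => ?_
  rw [cj_cj]
  exact hg _

theorem of_mul_idem_eq_self_iff (h : IsLinearCharacter A ϑ) {g : G} :
    MonoidAlgebra.of ℂ G g * idem A ϑ = idem A ϑ ↔ ϑ g = 1 := by
  constructor
  · intro h1
    have h2 := congrArg (fun a => a.coeff g) h1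
    simp only [coeff_of_mul, coeff_idem, inv_mul_cancel, inv_one, h.map_one] at h2
    have h3 := mul_left_cancel₀ (inv_ne_zero (natCard_ne_zero A)) h2
    rw [h.map_inv] at h3
    exact inv_eq_one.1 h3.symm
  · intro h1
    have hg : g ∈ A := h.mem_of_mem_charKer (h.mem_charKer.2 h1)
    rw [of_mul_idem h hg, h1, one_smul]

theorem mem_fixer_idem (h : IsLinearCharacter A ϑ) {g : G} :
    g ∈ fixer (idem A ϑ) ↔ ∀ x : G, ϑ (x * g * x⁻¹) = 1 := by
  refine forall_congr' fun x => ?_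
  rw [← of_mul_idem_eq_self_iff h, ← (cj (k := ℂ) x).injective.eq_iff (b := idem A ϑ), map_mul,
    cj_of]
  simp only [mul_assoc, inv_mul_cancel, mul_one, inv_mul_cancel_left]

/-- Equality in the triangle inequality: every real part must be `1`, and the norm bound then kills
the imaginary parts. -/
theorem eq_one_of_sum_eq_card {ι : Type*} {s : Finset ι} {f : ι → ℂ} (hf : ∀ i ∈ s, ‖f i‖ ≤ 1)
    (hs : ∑ i ∈ s, f i = s.card) : ∀ i ∈ s, f i = 1 := by
  have hre : ∀ i ∈ s, (f i).re ≤ 1 := fun i hi => (Complex.re_le_norm _).trans (hf i hi)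
  have h1 : ∑ i ∈ s, (1 - (f i).re) = 0 := by
    rw [Finset.sum_sub_distrib, ← Complex.re_sum, hs]
    simp
  intro i hi
  have h2 := (Finset.sum_eq_zero_iff_of_nonneg fun i hi => sub_nonneg.2 (hre i hi)).1 h1 i hi
  have h3 : (f i).re = 1 := by linarith
  have h4 : (f i).im = 0 := by
    have h5 := hf i hi
    rw [← sq_le_one_iff₀ (norm_nonneg _), Complex.sq_norm, Complex.normSq_apply, h3] at h5
    nlinarith [sq_nonneg (f i).im]
  exact Complex.ext h3 h4

/-- The value of `ϑ ^ G` at `g` equals its degree only if every summand `ϑ (x * g * x⁻¹)` is `1`.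
Hence `fixer` expresses the condition `ker ϑ ^ G = N` through the idempotent alone. -/
theorem charKer_ind_top (h : IsLinearCharacter A ϑ) :
    charKer (ind A ⊤ ϑ) = fixer (idem A ϑ) := by
  classical
  ext g
  rw [mem_fixer_idem h, charKer, Set.mem_ofPred_eq, ind, ind]
  simp only [Subgroup.mem_top, Finset.filter_true, mul_one, mul_inv_cancel, h.map_one,
    Finset.sum_const, nsmul_eq_mul]
  constructor
  · intro h1
    have h2 := mul_left_cancel₀ (inv_ne_zero (natCard_ne_zero A)) h1
    intro x
    exact eq_one_of_sum_eq_card (s := Finset.univ) (f := fun x => ϑ (x * g * x⁻¹))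
      (fun x _ => h.norm_le_one _) h2 x (Finset.mem_univ x)
  · intro h1
    simp [h1]

theorem coeff_trInd_idem (A H : Subgroup G) (ϑ : G → ℂ) (g : G) :
    (trInd A H (idem A ϑ)).coeff g = (Nat.card A : ℂ)⁻¹ * ind A H ϑ g⁻¹ := by
  classical
  rw [trInd_apply, MonoidAlgebra.coeff_smul_apply, MonoidAlgebra.coeff_sum,
    Finsupp.finsetSum_apply, ind, smul_eq_mul]
  congr 1
  rw [Finset.mul_sum]
  refine Finset.sum_congr rfl fun x _ => ?_
  rw [coeff_cj, coeff_idem]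
  congr 2
  group

/-- Translates the equation in the definition of a good leaf into idempotents: the coefficients of
`trInd A H (idem A ϑ)` are the values of `ϑ ^ H` at inverses, up to the rational factor `|A|⁻¹`. -/
theorem cj_trInd_idem_eq_gal_iff (x : G) (σ : ℂ ≃+* ℂ) :
    cj x (trInd A H (idem A ϑ)) = gal σ (trInd A H (idem A ϑ)) ↔
      ∀ g, ind A H ϑ (x * g * x⁻¹) = σ (ind A H ϑ g) := by
  have key : ∀ g, (cj x (trInd A H (idem A ϑ))).coeff g = (gal σ (trInd A H (idem A ϑ))).coeff g ↔
      ind A H ϑ (x * g⁻¹ * x⁻¹) = σ (ind A H ϑ g⁻¹) := by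
    intro g
    rw [coeff_cj, coeff_gal, coeff_trInd_idem, coeff_trInd_idem, map_mul, map_inv₀, map_natCast,
      mul_right_inj' (inv_ne_zero (natCard_ne_zero A))]
    simp only [mul_inv_rev, inv_inv, mul_assoc]
  constructor
  · intro h g
    have := (key g⁻¹).1 (by rw [h])
    rwa [inv_inv] at this
  · intro h
    ext g
    exact (key g).2 (h _)

end Fixer

end ShodaPairs

namespace ShodaPairs

variable {G : Type*} [Group G] [Fintype G]

/-! ### The rational element `ε(H, K)` inside `ℂG` -/

section Rational

/-- The inclusion `ℚG → ℂG`. -/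
noncomputable def toComplex : MonoidAlgebra ℚ G →+* MonoidAlgebra ℂ G :=
  MonoidAlgebra.mapRingHom G (algebraMap ℚ ℂ)

omit [Fintype G] in
theorem coeff_toComplex (a : MonoidAlgebra ℚ G) (g : G) :
    (toComplex a).coeff g = (a.coeff g : ℂ) := by
  simp [toComplex]

omit [Fintype G] in
theorem toComplex_injective : Function.Injective (toComplex (G := G)) := by
  intro a b h
  ext g
  have := congrArg (fun x => x.coeff g) h
  simpa only [coeff_toComplex, Rat.cast_inj] using this

omit [Fintype G] in
theorem toComplex_smul (c : ℚ) (a : MonoidAlgebra ℚ G) :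
    toComplex (c • a) = (c : ℂ) • toComplex a := by
  ext g
  simp [coeff_toComplex]

omit [Fintype G] in
theorem toComplex_cj (x : G) (a : MonoidAlgebra ℚ G) :
    toComplex (cj x a) = cj x (toComplex a) := by
  ext g
  simp only [coeff_cj, coeff_toComplex]

omit [Fintype G] in
theorem gal_toComplex (σ : ℂ ≃+* ℂ) (a : MonoidAlgebra ℚ G) :
    gal σ (toComplex a) = toComplex a := by
  ext g
  simp only [coeff_gal, coeff_toComplex, map_ratCast]

theorem toComplex_hat (L : Subgroup G) : toComplex (hat L) = idem L (triv L) := by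
  classical
  ext g
  rw [coeff_toComplex, coeff_idem, hat, MonoidAlgebra.coeff_smul_apply, MonoidAlgebra.coeff_sum,
    Finsupp.finsetSum_apply]
  by_cases hg : g ∈ L
  · rw [triv_apply_mem (L.inv_mem hg), Finset.sum_eq_single g]
    · simp
    · intro b _ hb
      simp [hb]
    · simp [hg]
  · rw [(isLinearCharacter_triv L).eq_zero fun h => hg (inv_mem_iff.1 h), Finset.sum_eq_zero]
    · simp
    · intro b hb
      have : b ≠ g := by
        rintro rfl
        exact hg (by simpa using hb)
      simp [this]

theorem exists_isMinimalNormalAbove_le {H K M : Subgroup G} (hM : IsNormalAbove H K M) :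
    ∃ L, IsMinimalNormalAbove H K L ∧ L ≤ M := by
  obtain ⟨L, hLM, hL⟩ := (Set.toFinite {L | IsNormalAbove H K L}).exists_le_minimal hM
  exact ⟨L, ⟨hL.prop, fun M' hM' hle => hL.eq_of_le hM' hle⟩, hLM⟩

theorem mem_minimalNormalsAbove {H K L : Subgroup G} :
    L ∈ minimalNormalsAbove H K ↔ IsMinimalNormalAbove H K L := by
  simp [minimalNormalsAbove]

omit [Fintype G] in
theorem IsLinearCharacter.ker_normal {H : Subgroup G} {φ : G → ℂ} (h : IsLinearCharacter H φ) :
    (h.ker.subgroupOf H).Normal := by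
  refine ⟨fun k hk x => ?_⟩
  rw [Subgroup.mem_subgroupOf, h.mem_ker] at hk ⊢
  rw [← hk]
  exact h.conj_mem x.2 k

omit [Fintype G] in
theorem IsLinearCharacter.commutator_mem_charKer {H : Subgroup G} {φ : G → ℂ}
    (h : IsLinearCharacter H φ) {a b : G} (ha : a ∈ H) (hb : b ∈ H) :
    a⁻¹ * b⁻¹ * a * b ∈ charKer φ := by
  rw [h.mem_charKer, h.mul_right _ hb, h.mul_right _ ha, h.mul_right _ (H.inv_mem hb), h.map_inv,
    h.map_inv]
  field_simp [h.ne_zero ha, h.ne_zero hb]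

theorem hat_mul_idem_of_le {H L : Subgroup G} {φ : G → ℂ} (h : IsLinearCharacter H φ)
    (hL : L ≤ h.ker) : toComplex (hat L) * idem H φ = idem H φ := by
  rw [toComplex_hat]
  refine idem_mul_idem_of_le (isLinearCharacter_triv L) h (hL.trans h.ker_le) fun a ha => ?_
  rw [triv_apply_mem ha, h.mem_ker.1 (hL ha)]

theorem hat_mul_idem_of_not_le {H L : Subgroup G} {φ : G → ℂ} (h : IsLinearCharacter H φ)
    (hLH : L ≤ H) (hL : ¬ L ≤ h.ker) : toComplex (hat L) * idem H φ = 0 := by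
  rw [toComplex_hat]
  refine idem_mul_idem_of_not_le (isLinearCharacter_triv L) h hLH fun hr => hL fun a ha => ?_
  rw [h.mem_ker, hr a ha, triv_apply_mem ha]

theorem epsilon_mul_hat {H K : Subgroup G} (hKH : K ≤ H) (hHK : H ≠ K) :
    toComplex (epsilon H K) * toComplex (hat K) = toComplex (epsilon H K) := by
  classical
  obtain ⟨L, hL, -⟩ := exists_isMinimalNormalAbove_le (H := H) (K := K) (M := H)
    ⟨lt_of_le_of_ne hKH (Ne.symm hHK), le_rfl, by rw [Subgroup.subgroupOf_self]; infer_instance⟩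
  have hLm := mem_minimalNormalsAbove.2 hL
  rw [epsilon, if_neg hHK, ← Finset.noncommProd_erase_mul _ hLm, map_mul, mul_assoc, map_sub,
    sub_mul, toComplex_hat, toComplex_hat, idem_mul_idem (isLinearCharacter_triv K)]
  congr 2
  rw [cen_commute (idem_mem_cen (isLinearCharacter_triv L))
    (supp_mono hL.1.1.le (idem_mem_supp (isLinearCharacter_triv K)))]
  exact idem_mul_idem_of_le (isLinearCharacter_triv K) (isLinearCharacter_triv L) hL.1.1.le
    fun a ha => by rw [triv_apply_mem ha, triv_apply_mem (hL.1.1.le ha)]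

open Classical in
-- If `ker φ = K`, then `φ` is nontrivial on every minimal `L`, so each factor `K̂ - L̂` fixes the
-- idempotent. If `ker φ` is larger, it contains some minimal `L`, and that factor kills it.
theorem epsilon_mul_idem {H K : Subgroup G} (hHK : H ≠ K) {φ : G → ℂ}
    (h : IsLinearCharacter H φ) (hK : K ≤ h.ker) :
    toComplex (epsilon H K) * idem H φ = if charKer φ = K then idem H φ else 0 := by
  rw [epsilon, if_neg hHK]
  split_ifs with hker
  · refine Finset.noncommProd_induction _ _ _ (fun x => toComplex x * idem H φ = idem H φ)
      ?_ ?_ ?_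
    · intro a b ha hb
      rw [map_mul, mul_assoc, hb, ha]
    · rw [map_one, one_mul]
    · intro L hL
      have hL := (mem_minimalNormalsAbove.1 hL).1
      rw [map_sub, sub_mul, hat_mul_idem_of_le h hK, hat_mul_idem_of_not_le h hL.2.1, sub_zero]
      intro hle
      have h1 : h.ker = K := SetLike.coe_injective hker
      exact hL.1.not_ge (h1 ▸ hle)
  · have hlt : K < h.ker := lt_of_le_of_ne hK fun h1 => hker (by rw [h1]; rfl)
    obtain ⟨L, hL, hle⟩ := exists_isMinimalNormalAbove_le (H := H) (K := K) (M := h.ker)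
      ⟨hlt, h.ker_le, h.ker_normal⟩
    rw [← Finset.noncommProd_erase_mul _ (mem_minimalNormalsAbove.2 hL), map_mul, mul_assoc,
      map_sub, sub_mul, hat_mul_idem_of_le h hK, hat_mul_idem_of_le h hle, sub_self, mul_zero]

open Classical in
/-- The linear characters of `H` with kernel `K`. -/
noncomputable def faithfulChars (H K : Subgroup G) : Finset (G → ℂ) :=
  (linChars H).filter fun φ => charKer φ = K

theorem mem_faithfulChars {H K : Subgroup G} {φ : G → ℂ} :
    φ ∈ faithfulChars H K ↔ IsLinearCharacter H φ ∧ charKer φ = K := by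
  classical
  rw [faithfulChars, Finset.mem_filter, mem_linChars]

theorem toComplex_epsilon {H K : Subgroup G} (hKH : K ≤ H) (hK : (K.subgroupOf H).Normal)
    (hc : ∀ a ∈ H, ∀ b ∈ H, a⁻¹ * b⁻¹ * a * b ∈ K) :
    toComplex (epsilon H K) = ∑ φ ∈ faithfulChars H K, idem H φ := by
  classical
  by_cases hHK : H = K
  · rw [epsilon, if_pos hHK, Finset.sum_eq_single (triv K)]
    · rw [toComplex_hat, hHK]
    · intro φ hφ hne
      obtain ⟨h1, h2⟩ := mem_faithfulChars.1 hφ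
      subst hHK
      refine absurd (h1.ext_of_mem (isLinearCharacter_triv H) fun a ha => ?_) hne
      rw [triv_apply_mem ha, ← h1.mem_charKer, h2]
      exact ha
    · intro h
      exact absurd (mem_faithfulChars.2 ⟨hHK ▸ isLinearCharacter_triv K, charKer_triv K⟩) h
  -- As `ε(H, K)` absorbs `K̂`, it suffices to multiply it with the idempotents of the characters
  -- trivial on `K`.
  · rw [← epsilon_mul_hat hKH hHK, toComplex_hat, ← sum_idem_eq_idem_triv hKH hK hc,
      Finset.mul_sum, faithfulChars, Finset.sum_filter, Finset.sum_filter]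
    refine Finset.sum_congr rfl fun φ hφ => ?_
    rw [mem_linChars] at hφ
    by_cases hk : ∀ k ∈ K, φ k = 1
    · rw [if_pos hk]
      exact epsilon_mul_idem hHK hφ fun k hkK => hφ.mem_ker.2 (hk k hkK)
    · rw [if_neg hk, if_neg]
      intro h1
      refine hk fun k hkK => hφ.mem_charKer.1 ?_
      rw [h1]
      exact hkK

end Rational

/-! ### Shoda pairs and irreducibility of the induced character -/

section Shoda

theorem IsLinearCharacter.isCyclic_quotient {H K : Subgroup G} {ϑ : G → ℂ}
    (h : IsLinearCharacter H ϑ) (hK : charKer ϑ = K) :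
    ∃ _ : (K.subgroupOf H).Normal, IsCyclic (H ⧸ K.subgroupOf H) := by
  obtain ⟨l, hl, -⟩ := id h
  have h1 : K.subgroupOf H = l.ker := by
    ext x
    rw [Subgroup.mem_subgroupOf, MonoidHom.mem_ker, Units.ext_iff, ← hl, Units.val_one,
      ← h.mem_charKer, hK]
    rfl
  rw [h1]
  refine ⟨inferInstance, ?_⟩
  have : Finite l.range := Set.finite_range l
  exact isCyclic_of_injective (QuotientGroup.quotientKerEquivRange l).toMonoidHom
    (QuotientGroup.quotientKerEquivRange l).injective

theorem exists_linearCharacter_of_isCyclic {H K : Subgroup G} (hKH : K ≤ H)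
    (hK : (K.subgroupOf H).Normal) (hcyc : IsCyclic (H ⧸ K.subgroupOf H)) :
    ∃ ϑ, IsLinearCharacter H ϑ ∧ charKer ϑ = K := by
  classical
  let Q := H ⧸ K.subgroupOf H
  have hne : NeZero (Nat.card Q) := ⟨Nat.card_pos.ne'⟩
  have hcard : Nat.card Q = Nat.card (rootsOfUnity (Nat.card Q) ℂ) := by
    rw [Complex.card_rootsOfUnity]
  let f : Q ≃* rootsOfUnity (Nat.card Q) ℂ := mulEquivOfCyclicCardEq hcard
  let l : H →* ℂˣ := ((rootsOfUnity (Nat.card Q) ℂ).subtype.comp f.toMonoidHom).comp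
    (QuotientGroup.mk' (K.subgroupOf H))
  have hϑ : IsLinearCharacter H (fun x => if hx : x ∈ H then (l ⟨x, hx⟩ : ℂ) else 0) :=
    ⟨l, fun a => by simp, fun x hx => by simp [hx]⟩
  refine ⟨_, hϑ, ?_⟩
  ext x
  rw [hϑ.mem_charKer]
  by_cases hx : x ∈ H
  · simp only [hx, dite_true, Units.val_eq_one]
    have h1 : l ⟨x, hx⟩ = 1 ↔ f (QuotientGroup.mk ⟨x, hx⟩) = 1 := by
      rw [Subtype.ext_iff]
      rfl
    rw [h1, map_eq_one_iff f f.injective, QuotientGroup.eq_one_iff, Subgroup.mem_subgroupOf]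
    rfl
  · simp only [hx, dite_false, zero_ne_one, false_iff]
    exact fun h => hx (hKH h)

/-- Mackey's criterion at `g`: the product vanishes exactly when `ϑ` and its conjugate disagree on
the intersection of their domains. -/
theorem idem_mul_cj_idem_eq_zero_iff {H : Subgroup G} {ϑ : G → ℂ} (h : IsLinearCharacter H ϑ)
    (g : G) : idem H ϑ * cj g (idem H ϑ) = 0 ↔
      ∃ x ∈ H, g⁻¹ * x * g ∈ H ∧ ϑ (g⁻¹ * x * g) ≠ ϑ x := by
  classical
  constructor
  · intro h0
    by_contra! hne
    -- If the characters agree there, the coefficient of the product at `1` is `|H|⁻²` times the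
    -- order of the intersection, which is positive.
    have h1 : ∑ x : G, (if x ∈ H ∧ g * x * g⁻¹ ∈ H then 1 else 0 : ℂ) = 0 := by
      have h2 := congrArg (fun a => a.coeff 1) h0
      rw [mul_eq_sum_coeff] at h2
      simp only [MonoidAlgebra.coeff_sum, MonoidAlgebra.coeff_zero, Finsupp.coe_zero, Pi.zero_apply, Finsupp.finsetSum_apply,
        MonoidAlgebra.coeff_smul_apply, coeff_of_mul, coeff_cj, coeff_idem, smul_eq_mul] at h2
      have h3 : ∀ x : G, (Nat.card H : ℂ)⁻¹ * ϑ x⁻¹ *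
          ((Nat.card H : ℂ)⁻¹ * ϑ (g * (x⁻¹ * 1) * g⁻¹)⁻¹) =
          (Nat.card H : ℂ)⁻¹ * (Nat.card H : ℂ)⁻¹ *
            (if x ∈ H ∧ g * x * g⁻¹ ∈ H then 1 else 0 : ℂ) := by
        intro x
        have h4 : (g * (x⁻¹ * 1) * g⁻¹)⁻¹ = g * x * g⁻¹ := by group
        rw [h4]
        split_ifs with hx
        · have h5 : g⁻¹ * (g * x * g⁻¹) * g = x := by group
          have h6 := hne _ hx.2 (by rw [h5]; exact hx.1)
          rw [h5] at h6
          rw [← h6, h.map_inv]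
          have := h.ne_zero hx.1
          field_simp
        · rw [not_and_or] at hx
          rcases hx with hx | hx
          · rw [h.eq_zero fun h' => hx (inv_mem_iff.1 h')]
            ring
          · rw [h.eq_zero hx]
            ring
      rw [Finset.sum_congr rfl fun x _ => h3 x, ← Finset.mul_sum] at h2
      exact (mul_eq_zero.1 h2).resolve_left
        (mul_ne_zero (inv_ne_zero (natCard_ne_zero H)) (inv_ne_zero (natCard_ne_zero H)))
    rw [Finset.sum_boole, Nat.cast_eq_zero, Finset.card_eq_zero] at h1
    have h2 : (1 : G) ∈ Finset.univ.filter fun x : G => x ∈ H ∧ g * x * g⁻¹ ∈ H := by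
      simp [H.one_mem]
    rw [h1] at h2
    exact Finset.notMem_empty _ h2
  · rintro ⟨x, hx, hy, hne⟩
    refine idem_mul_eq_zero h hy (c := ϑ x) ?_ hne.symm
    rw [← cj_of, ← map_mul, of_mul_idem h hx, map_smul]

/-- A commutator `x⁻¹ * (g⁻¹ * x * g)` in `H` lies in `K = ker ϑ` exactly when `ϑ` agrees at `x` and
`g⁻¹ * x * g`; so Shoda's condition is Mackey's criterion for all `g` outside `H`. -/
theorem isShodaPair_iff {H K : Subgroup G} {ϑ : G → ℂ} (h : IsLinearCharacter H ϑ)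
    (hK : charKer ϑ = K) : IsShodaPair (H, K) ↔ IsClifford ⊤ H (idem H ϑ) := by
  have hKH : K ≤ H := fun k hk => h.mem_of_mem_charKer (by rw [hK]; exact hk)
  have key : ∀ g, (∀ x ∈ H, x⁻¹ * g⁻¹ * x * g ∈ H → x⁻¹ * g⁻¹ * x * g ∈ K) ↔
      ¬ ∃ x ∈ H, g⁻¹ * x * g ∈ H ∧ ϑ (g⁻¹ * x * g) ≠ ϑ x := by
    intro g
    push Not
    refine forall₂_congr fun x hx => ?_
    have h1 : x⁻¹ * g⁻¹ * x * g = x⁻¹ * (g⁻¹ * x * g) := by group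
    rw [h1, H.mul_mem_cancel_left (H.inv_mem hx)]
    refine imp_congr_right fun _ => ?_
    rw [← SetLike.mem_coe, ← hK, h.mem_charKer, h.mul_left (H.inv_mem hx), h.map_inv,
      inv_mul_eq_one₀ (h.ne_zero hx), eq_comm]
  constructor
  · intro hS
    refine ⟨le_top, idem_mem_cen h, idem_mul_idem h, fun g _ hg => ?_⟩
    rw [idem_mul_cj_idem_eq_zero_iff h]
    by_contra hne
    exact hg (hS.2.2 g ((key g).2 hne))
  · intro hC
    refine ⟨hKH, h.isCyclic_quotient hK, fun g hg => ?_⟩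
    by_contra hgH
    exact (key g).1 hg ((idem_mul_cj_idem_eq_zero_iff h g).1 (hC.orth g trivial hgH))

end Shoda

/-! ### The primitive central idempotent realized by a Shoda pair -/

section Realized

theorem sum_eq_card_smul_sum_image {α M : Type*} [AddCommMonoid M] [DecidableEq M] (s : Finset α)
    (F : α → M) (m : ℕ) (hm : ∀ a ∈ s, (s.filter fun b => F b = F a).card = m) :
    ∑ a ∈ s, F a = m • ∑ x ∈ s.image F, x := by
  rw [Finset.sum_comp (fun x => x) F, Finset.smul_sum]
  refine Finset.sum_congr rfl fun x hx => ?_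
  obtain ⟨a, ha, rfl⟩ := Finset.mem_image.1 hx
  rw [hm a ha]

open Classical in
theorem sum_cj_epsilon (H K : Subgroup G) : ∃ m : ℕ,
    ∑ g : G, cj g (epsilon H K) = m • conjSum H K := by
  refine ⟨(Finset.univ.filter fun b : G => cj b (epsilon H K) = epsilon H K).card, ?_⟩
  rw [conjSum]
  simp only [← cj_eq]
  refine sum_eq_card_smul_sum_image _ _ _ fun a _ => ?_
  refine Finset.card_bij' (fun b _ => b * a⁻¹) (fun b _ => b * a) ?_ ?_ ?_ ?_
  · intro b hb
    simp only [Finset.mem_filter, Finset.mem_univ, true_and] at hb ⊢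
    rw [← cj_cj, hb, cj_cj, mul_inv_cancel, cj_one]
  · intro b hb
    simp only [Finset.mem_filter, Finset.mem_univ, true_and] at hb ⊢
    rw [← cj_cj, hb]
  · simp
  · simp

/-- The central idempotent of the character of `G` induced by the linear character `ϑ` of `H`
when this character is irreducible. -/
noncomputable def indIdem (H : Subgroup G) (ϑ : G → ℂ) : MonoidAlgebra ℂ G :=
  trInd H ⊤ (idem H ϑ)

theorem gal_indIdem (σ : ℂ ≃+* ℂ) (H : Subgroup G) (ϑ : G → ℂ) :
    gal σ (indIdem H ϑ) = indIdem H (fun g => σ (ϑ g)) := by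
  rw [indIdem, gal_trInd, gal_idem, indIdem]

theorem isBlock_indIdem {H : Subgroup G} {ϑ : G → ℂ} (h : IsLinearCharacter H ϑ)
    (hC : IsClifford ⊤ H (idem H ϑ)) : IsBlock ⊤ (indIdem H ϑ) :=
  hC.isBlock_trInd (isBlock_idem h) (idem_mul_idem h)

omit [Fintype G] in
theorem charKer_comp_ringEquiv {H : Subgroup G} {ϑ : G → ℂ} (h : IsLinearCharacter H ϑ)
    (σ : ℂ ≃+* ℂ) : charKer (fun g => σ (ϑ g)) = charKer ϑ := by
  ext g
  rw [(h.comp_ringEquiv σ).mem_charKer, h.mem_charKer, map_eq_one_iff σ σ.injective]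

theorem mem_supp_top (a : MonoidAlgebra ℂ G) : a ∈ supp ⊤ := fun _ hg => absurd trivial hg

theorem toComplex_mem_cen {a : MonoidAlgebra ℚ G} (ha : a ∈ Subring.center (MonoidAlgebra ℚ G)) :
    toComplex a ∈ cen ⊤ := by
  refine ⟨mem_supp_top _, fun h _ => ?_⟩
  rw [← toComplex_cj, cj_eq, mul_assoc, ← Subring.mem_center_iff.1 ha, ← mul_assoc, ← map_mul,
    inv_mul_cancel, map_one, one_mul]

variable {H K : Subgroup G} {ϑ : G → ℂ}

open Classical in
-- Sum the induced idempotents over all characters of `H` with kernel `K`. By the formula for `ε(H,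
-- K)` this is a rational multiple of `e(G, H, K)`; it is also a multiple of the sum of the distinct
-- ones, each being hit equally often.
theorem exists_smul_conjSum (hS : IsShodaPair (H, K)) (h : IsLinearCharacter H ϑ)
    (hK : charKer ϑ = K) : ∃ a : ℚ,
      toComplex (a • conjSum H K) = ∑ x ∈ (faithfulChars H K).image (indIdem H), x := by
  have hKH : K ≤ H := hS.1
  have hKn := hS.2.1.1
  have hc : ∀ a ∈ H, ∀ b ∈ H, a⁻¹ * b⁻¹ * a * b ∈ K := fun a ha b hb => by
    have := h.commutator_mem_charKer ha hb
    rwa [hK] at this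
  obtain ⟨m, hm⟩ := sum_cj_epsilon H K
  -- The fibres of `indIdem H` have equal size since `Aut(ℂ)` is transitive on the characters with
  -- kernel `K`.
  have hsum := sum_eq_card_smul_sum_image (faithfulChars H K) (indIdem H)
    ((faithfulChars H K).filter fun ψ => indIdem H ψ = indIdem H ϑ).card (by
      intro φ hφ
      obtain ⟨h1, h2⟩ := mem_faithfulChars.1 hφ
      obtain ⟨σ, hσ⟩ := h.exists_ringEquiv_of_charKer_eq h1 (hK.trans h2.symm)
      have hφσ : φ = fun g => σ (ϑ g) := funext hσ
      have hmem : ∀ (τ : ℂ ≃+* ℂ) ψ, ψ ∈ faithfulChars H K →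
          (fun g => τ (ψ g)) ∈ faithfulChars H K := fun τ ψ hψ => by
        obtain ⟨h3, h4⟩ := mem_faithfulChars.1 hψ
        exact mem_faithfulChars.2 ⟨h3.comp_ringEquiv τ, (charKer_comp_ringEquiv h3 τ).trans h4⟩
      refine Finset.card_bij' (fun ψ _ => fun g => σ.symm (ψ g)) (fun ψ _ => fun g => σ (ψ g))
        ?_ ?_ ?_ ?_
      · intro ψ hψ
        rw [Finset.mem_filter] at hψ ⊢
        refine ⟨hmem _ _ hψ.1, ?_⟩
        rw [← gal_indIdem, hψ.2, hφσ, ← gal_indIdem, gal_symm_gal]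
      · intro ψ hψ
        rw [Finset.mem_filter] at hψ ⊢
        refine ⟨hmem _ _ hψ.1, ?_⟩
        rw [← gal_indIdem, hψ.2, hφσ, ← gal_indIdem]
      · intro ψ _
        simp
      · intro ψ _
        simp)
  set n := ((faithfulChars H K).filter fun ψ => indIdem H ψ = indIdem H ϑ).card with hn
  have hn0 : (n : ℂ) ≠ 0 := Nat.cast_ne_zero.2 (Finset.card_ne_zero_of_mem (a := ϑ)
    (Finset.mem_filter.2 ⟨mem_faithfulChars.2 ⟨h, hK⟩, rfl⟩))
  have h1 : ∑ φ ∈ faithfulChars H K, indIdem H φ =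
      ((Nat.card H : ℂ)⁻¹ * m) • toComplex (conjSum H K) := by
    simp only [indIdem]
    rw [← map_sum, ← toComplex_epsilon hKH hKn hc, trInd_apply, mul_smul, Nat.cast_smul_eq_nsmul,
      ← map_nsmul, ← hm, map_sum]
    simp only [Subgroup.mem_top, Finset.filter_true, toComplex_cj]
  refine ⟨(n : ℚ)⁻¹ * ((Nat.card H : ℚ)⁻¹ * m), ?_⟩
  rw [h1, ← Nat.cast_smul_eq_nsmul ℂ] at hsum
  rw [toComplex_smul, Rat.cast_mul, mul_smul, Rat.cast_mul]
  simp only [Rat.cast_inv, Rat.cast_natCast]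
  rw [hsum, smul_smul, inv_mul_cancel₀ hn0, one_smul]

theorem exists_gal_of_mem_faithfulChars (h : IsLinearCharacter H ϑ) (hK : charKer ϑ = K)
    {φ : G → ℂ} (hφ : φ ∈ faithfulChars H K) : ∃ σ : ℂ ≃+* ℂ,
      indIdem H φ = gal σ (indIdem H ϑ) := by
  obtain ⟨h1, h2⟩ := mem_faithfulChars.1 hφ
  obtain ⟨σ, hσ⟩ := h.exists_ringEquiv_of_charKer_eq h1 (hK.trans h2.symm)
  refine ⟨σ, ?_⟩
  rw [gal_indIdem, ← funext hσ]

open Classical in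
theorem sum_image_mul (hS : IsShodaPair (H, K)) {φ : G → ℂ} (hφ : φ ∈ faithfulChars H K) :
    (∑ x ∈ (faithfulChars H K).image (indIdem H), x) * indIdem H φ = indIdem H φ := by
  have hb : ∀ ψ ∈ faithfulChars H K, IsBlock ⊤ (indIdem H ψ) := fun ψ hψ => by
    obtain ⟨h1, h2⟩ := mem_faithfulChars.1 hψ
    exact isBlock_indIdem h1 ((isShodaPair_iff h1 h2).1 hS)
  rw [Finset.sum_mul, Finset.sum_eq_single (indIdem H φ)]
  · exact (hb φ hφ).idem
  · intro x hx hne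
    obtain ⟨ψ, hψ, rfl⟩ := Finset.mem_image.1 hx
    by_contra h0
    exact hne ((hb ψ hψ).eq_of_mul_ne_zero (hb φ hφ) h0)
  · intro h1
    exact absurd (Finset.mem_image_of_mem _ hφ) h1

open Classical in
-- The sum runs over a single Galois orbit of blocks. A rational central idempotent is Galois
-- invariant, so it kills all blocks of the orbit or fixes all of them.
theorem isPrimitiveCentralIdempotent_of_toComplex_eq (hS : IsShodaPair (H, K))
    (h : IsLinearCharacter H ϑ) (hK : charKer ϑ = K) {r : MonoidAlgebra ℚ G}
    (hr : toComplex r = ∑ x ∈ (faithfulChars H K).image (indIdem H), x) :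
    IsPrimitiveCentralIdempotent r := by
  set s := ∑ x ∈ (faithfulChars H K).image (indIdem H), x with hs
  have hϑ : ϑ ∈ faithfulChars H K := mem_faithfulChars.2 ⟨h, hK⟩
  have hb := isBlock_indIdem h ((isShodaPair_iff h hK).1 hS)
  have hsf := sum_image_mul hS hϑ
  have hscen : s ∈ cen ⊤ := by
    refine sum_mem fun x hx => ?_
    obtain ⟨ψ, hψ, rfl⟩ := Finset.mem_image.1 hx
    exact trInd_mem_cen le_top (idem_mem_supp (mem_faithfulChars.1 hψ).1)
  have hss : s * s = s := by
    conv_lhs => rw [hs, Finset.mul_sum]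
    rw [hs]
    refine Finset.sum_congr rfl fun x hx => ?_
    obtain ⟨ψ, hψ, rfl⟩ := Finset.mem_image.1 hx
    exact sum_image_mul hS hψ
  refine ⟨?_, ?_, ?_, ?_⟩
  · rw [Subring.mem_center_iff]
    intro b
    apply toComplex_injective
    rw [map_mul, map_mul, hr, cen_commute hscen (mem_supp_top _)]
  · apply toComplex_injective
    rw [map_mul, hr, hss]
  · rintro rfl
    rw [map_zero] at hr
    rw [← hs, ← hr, zero_mul] at hsf
    exact hb.ne_zero hsf.symm
  · intro f hf f' hf' hff hff' h0 hsum
    have hcomm : f' * f = 0 := by rw [Subring.mem_center_iff.1 hf f', h0]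
    have hrf : r * f = f := by rw [hsum, add_mul, hff.eq, hcomm, add_zero]
    have key : ∀ x ∈ (faithfulChars H K).image (indIdem H), ∃ σ, x = gal σ (indIdem H ϑ) := by
      intro x hx
      obtain ⟨ψ, hψ, rfl⟩ := Finset.mem_image.1 hx
      exact exists_gal_of_mem_faithfulChars h hK hψ
    rcases hb.mul_eq_zero_or (toComplex_mem_cen hf) (by rw [← map_mul, hff.eq]) with h1 | h1
    · left
      rw [← hrf]
      apply toComplex_injective
      rw [map_mul, hr, map_zero, hs, Finset.sum_mul]
      refine Finset.sum_eq_zero fun x hx => ?_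
      obtain ⟨σ, rfl⟩ := key x hx
      rw [← gal_toComplex σ f, ← map_mul, h1, map_zero]
    · right
      have h2 : r * f = r := by
        apply toComplex_injective
        rw [map_mul, hr, hs, Finset.sum_mul]
        refine Finset.sum_congr rfl fun x hx => ?_
        obtain ⟨σ, rfl⟩ := key x hx
        rw [← gal_toComplex σ f, ← map_mul, h1]
      rw [hrf] at h2
      rw [h2] at hsum
      exact left_eq_add.1 hsum

omit [Fintype G] in
-- Uniqueness of `α`: idempotency of `a • C` with `a ≠ 0` gives `a • (C * C) = C`, and `C * C ≠ 0`.
theorem smul_eq_of_isPrimitiveCentralIdempotent {C : MonoidAlgebra ℚ G} {a b : ℚ}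
    (ha : IsPrimitiveCentralIdempotent (a • C)) (hb : IsPrimitiveCentralIdempotent (b • C)) :
    a = b := by
  have key : ∀ {a : ℚ}, IsPrimitiveCentralIdempotent (a • C) → a • (C * C) = C := by
    intro a ha
    have ha0 : a ≠ 0 := by
      rintro rfl
      exact ha.2.2.1 (zero_smul _ _)
    have h1 := ha.2.1.eq
    rw [smul_mul_smul_comm, mul_smul] at h1
    exact smul_right_injective _ ha0 h1
  have hC : C * C ≠ 0 := by
    intro h0
    have h1 := key ha
    rw [h0, smul_zero] at h1
    exact ha.2.2.1 (by rw [← h1, smul_zero])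
  exact smul_left_injective ℚ hC ((key ha).trans (key hb).symm)

open Classical in
theorem toComplex_realized (hS : IsShodaPair (H, K)) (h : IsLinearCharacter H ϑ)
    (hK : charKer ϑ = K) :
    toComplex (realized (H, K)) = ∑ x ∈ (faithfulChars H K).image (indIdem H), x := by
  obtain ⟨a, ha⟩ := exists_smul_conjSum hS h hK
  have h1 := isPrimitiveCentralIdempotent_of_toComplex_eq hS h hK ha
  have h2 : ∃ a : ℚ, IsPrimitiveCentralIdempotent (a • conjSum H K) := ⟨a, h1⟩
  have h3 : alpha (H, K) = a := by
    rw [alpha, dif_pos h2]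
    exact smul_eq_of_isPrimitiveCentralIdempotent h2.choose_spec h1
  rw [realized, h3, ha]

theorem isPrimitiveCentralIdempotent_realized (hS : IsShodaPair (H, K))
    (h : IsLinearCharacter H ϑ) (hK : charKer ϑ = K) :
    IsPrimitiveCentralIdempotent (realized (H, K)) :=
  isPrimitiveCentralIdempotent_of_toComplex_eq hS h hK (toComplex_realized hS h hK)

theorem IsPrimitiveCentralIdempotent.eq_of_mul_ne_zero {R : Type*} [Ring R] {e f : R}
    (he : IsPrimitiveCentralIdempotent e) (hf : IsPrimitiveCentralIdempotent f)
    (h : e * f ≠ 0) : e = f := by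
  have key : ∀ {e f : R}, IsPrimitiveCentralIdempotent e → IsPrimitiveCentralIdempotent f →
      e * f ≠ 0 → e * f = e := by
    intro e f he hf h
    have hc : e * f = f * e := Subring.mem_center_iff.1 hf.1 e
    have h1 : IsIdempotentElem (e * f) := he.2.1.mul_of_commute hc hf.2.1
    have h3 : (e * f) * (e - e * f) = 0 := by
      rw [mul_sub, h1.eq, hc, mul_assoc, he.2.1.eq, sub_self]
    have h4 : (e - e * f) * (e * f) = 0 := by
      rw [sub_mul, h1.eq, ← mul_assoc, he.2.1.eq, sub_self]
    have h2 : IsIdempotentElem (e - e * f) := by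
      change (e - e * f) * (e - e * f) = _
      rw [mul_sub, h4, sub_zero, sub_mul, he.2.1.eq, mul_assoc, ← hc, ← mul_assoc, he.2.1.eq]
    rcases he.2.2.2 _ (mul_mem he.1 hf.1) _ (sub_mem he.1 (mul_mem he.1 hf.1)) h1 h2 h3
      (by abel) with h5 | h5
    · exact absurd h5 h
    · exact (sub_eq_zero.1 h5).symm
  have hc : e * f = f * e := Subring.mem_center_iff.1 hf.1 e
  rw [← key he hf h, hc]
  exact key hf he (by rwa [← hc])

/-- Two Shoda pairs realize the same primitive central idempotent if and only if the
corresponding induced characters are conjugate under `Aut(ℂ)`. -/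
theorem realized_eq_iff {H' K' : Subgroup G} {ϑ' : G → ℂ} (hS : IsShodaPair (H, K))
    (h : IsLinearCharacter H ϑ) (hK : charKer ϑ = K) (hS' : IsShodaPair (H', K'))
    (h' : IsLinearCharacter H' ϑ') (hK' : charKer ϑ' = K') :
    realized (H, K) = realized (H', K') ↔
      ∃ σ : ℂ ≃+* ℂ, gal σ (indIdem H ϑ) = indIdem H' ϑ' := by
  classical
  have hb := isBlock_indIdem h ((isShodaPair_iff h hK).1 hS)
  have hb' := isBlock_indIdem h' ((isShodaPair_iff h' hK').1 hS')
  have h1 : toComplex (realized (H, K)) * indIdem H ϑ = indIdem H ϑ := by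
    rw [toComplex_realized hS h hK]
    exact sum_image_mul hS (mem_faithfulChars.2 ⟨h, hK⟩)
  have h1' : toComplex (realized (H', K')) * indIdem H' ϑ' = indIdem H' ϑ' := by
    rw [toComplex_realized hS' h' hK']
    exact sum_image_mul hS' (mem_faithfulChars.2 ⟨h', hK'⟩)
  constructor
  · intro he
    -- The second block lies below the Galois orbit sum of the first, so it meets, and hence equals,
    -- one member of that orbit.
    rw [← he, toComplex_realized hS h hK, Finset.sum_mul] at h1'
    obtain ⟨x, hx, hne⟩ := Finset.exists_ne_zero_of_sum_ne_zero (h1' ▸ hb'.ne_zero)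
    obtain ⟨ψ, hψ, rfl⟩ := Finset.mem_image.1 hx
    obtain ⟨σ, hσ⟩ := exists_gal_of_mem_faithfulChars h hK hψ
    refine ⟨σ, ?_⟩
    rw [hσ] at hne
    exact (hb.gal σ).eq_of_mul_ne_zero hb' hne
  · rintro ⟨σ, hσ⟩
    refine (isPrimitiveCentralIdempotent_realized hS h hK).eq_of_mul_ne_zero
      (isPrimitiveCentralIdempotent_realized hS' h' hK') fun h0 => hb'.ne_zero ?_
    have h2 : toComplex (realized (H, K)) * indIdem H' ϑ' = indIdem H' ϑ' := by
      rw [← hσ, ← gal_toComplex σ, ← map_mul, h1]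
    rw [← h2, ← h1', ← mul_assoc, ← map_mul, h0, map_zero, zero_mul]

end Realized

end ShodaPairs

namespace ShodaPairs

variable {G : Type*} [Group G]

/-! ### Abelian normal subgroups modulo `ker ϑ` -/

section Pullback

variable {H K : Subgroup G}

/-- The preimage in `H` of a subgroup of `H ⧸ K`, as a subgroup of `G`. -/
def pullback [(K.subgroupOf H).Normal] (B : Subgroup (H ⧸ K.subgroupOf H)) : Subgroup G :=
  (B.comap (QuotientGroup.mk' _)).map H.subtype

theorem mem_pullback [(K.subgroupOf H).Normal] {B : Subgroup (H ⧸ K.subgroupOf H)} {g : G} :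
    g ∈ pullback B ↔ ∃ hg : g ∈ H, (QuotientGroup.mk ⟨g, hg⟩ : H ⧸ K.subgroupOf H) ∈ B := by
  simp [pullback, Subgroup.mem_map]

theorem pullback_le_pullback_iff [(K.subgroupOf H).Normal]
    {B C : Subgroup (H ⧸ K.subgroupOf H)} : pullback B ≤ pullback C ↔ B ≤ C := by
  rw [pullback, pullback, Subgroup.map_le_map_iff_of_injective H.subtype_injective,
    Subgroup.comap_le_comap_of_surjective (QuotientGroup.mk'_surjective _)]

theorem sup_center_commutative {Q : Type*} [Group Q] {B : Subgroup Q}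
    (hB : ∀ a ∈ B, ∀ b ∈ B, a * b = b * a) :
    ∀ a ∈ B ⊔ Subgroup.center Q, ∀ b ∈ B ⊔ Subgroup.center Q, a * b = b * a := by
  intro a ha b hb
  obtain ⟨x, hx, z, hz, rfl⟩ := Subgroup.mem_sup_of_normal_right.1 ha
  obtain ⟨y, hy, w, hw, rfl⟩ := Subgroup.mem_sup_of_normal_right.1 hb
  rw [Subgroup.mem_center_iff] at hz hw
  calc x * z * (y * w) = x * (z * y) * w := by simp only [mul_assoc]
    _ = (x * y) * (z * w) := by rw [← hz]; simp only [mul_assoc]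
    _ = (y * x) * (w * z) := by rw [hB x hx y hy, hw]
    _ = y * (x * w) * z := by simp only [mul_assoc]
    _ = y * w * (x * z) := by rw [hw]; simp only [mul_assoc]

end Pullback

namespace Triple.IsLinear

variable {v : Triple G} (hv : v.IsLinear)

include hv

theorem linear : IsLinearCharacter v.A v.ϑ := hv.2.2.1

theorem le_normalizer : v.H ≤ Subgroup.normalizer (v.A : Set G) :=
  (Subgroup.normal_subgroupOf_iff_le_normalizer hv.1).1 hv.2.1

theorem ker_normal : (hv.linear.ker.subgroupOf v.H).Normal := by
  refine ⟨fun k hk x => ?_⟩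
  rw [Subgroup.mem_subgroupOf, hv.linear.mem_ker] at hk ⊢
  rw [← hk]
  exact hv.2.2.2 x x.2 k

theorem isAbelianNormalAbove_pullback [hn : (hv.linear.ker.subgroupOf v.H).Normal]
    {B : Subgroup (v.H ⧸ hv.linear.ker.subgroupOf v.H)} (hB : B.Normal)
    (hc : ∀ a ∈ B, ∀ b ∈ B, a * b = b * a) : v.IsAbelianNormalAbove (pullback B) := by
  have hle : pullback B ≤ v.H := fun g hg => (mem_pullback.1 hg).1
  refine ⟨fun g hg => ?_, hle, ?_, fun a ha b hb => ?_⟩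
  · have hgH := hv.1 (hv.linear.mem_of_mem_charKer hg)
    refine mem_pullback.2 ⟨hgH, ?_⟩
    rw [(QuotientGroup.eq_one_iff (⟨g, hgH⟩ : v.H)).2 (Subgroup.mem_subgroupOf.2 hg)]
    exact B.one_mem
  · refine ⟨fun k hk x => ?_⟩
    rw [Subgroup.mem_subgroupOf] at hk ⊢
    obtain ⟨hkH, hk⟩ := mem_pullback.1 hk
    refine mem_pullback.2 ⟨(x * k * x⁻¹).2, ?_⟩
    exact hB.conj_mem _ hk (QuotientGroup.mk x)
  · obtain ⟨haH, ha⟩ := mem_pullback.1 ha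
    obtain ⟨hbH, hb⟩ := mem_pullback.1 hb
    have h1 := hc _ hb _ ha
    rw [← QuotientGroup.mk_mul, ← QuotientGroup.mk_mul, QuotientGroup.eq,
      Subgroup.mem_subgroupOf] at h1
    have h2 : a⁻¹ * b⁻¹ * a * b = (b * a)⁻¹ * (a * b) := by group
    rw [h2]
    exact h1

/-- Invariance of `ϑ` in `H` puts every commutator of `A` with `H` into `ker ϑ`. -/
theorem le_pullback_center [hn : (hv.linear.ker.subgroupOf v.H).Normal] :
    v.A ≤ pullback (Subgroup.center (v.H ⧸ hv.linear.ker.subgroupOf v.H)) := by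
  intro a ha
  refine mem_pullback.2 ⟨hv.1 ha, Subgroup.mem_center_iff.2 fun q => ?_⟩
  induction q using QuotientGroup.induction_on with | _ x => ?_
  rw [← QuotientGroup.mk_mul, ← QuotientGroup.mk_mul, QuotientGroup.eq, Subgroup.mem_subgroupOf,
    hv.linear.mem_ker]
  have h1 : (((x * ⟨a, hv.1 ha⟩)⁻¹ * (⟨a, hv.1 ha⟩ * x) : v.H) : G) =
      a⁻¹ * ((x : G)⁻¹ * a * (x : G)⁻¹⁻¹) := by
    push_cast
    group
  rw [h1, hv.linear.mul_left (v.A.inv_mem ha), hv.2.2.2 _ (v.H.inv_mem x.2), hv.linear.map_inv,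
    inv_mul_cancel₀ (hv.linear.ne_zero ha)]

end Triple.IsLinear

/-! ### Edges of the tree and the blocks attached to its nodes -/

namespace Choices

variable [Fintype G] (c : Choices G) {v : Triple G}

/-- Adjoining the center of `H / ker ϑ` to `𝒜` keeps it abelian and normal, so by maximality `𝒜`
already contains the center, and with it `A`. -/
theorem le_𝒜 (hv : v.IsLinear) : v.A ≤ c.𝒜 v := by
  have hn := hv.ker_normal
  obtain ⟨h1, h2, h3, h4⟩ := c.isAbelianNormalAbove v hv
  let Q := v.H ⧸ hv.linear.ker.subgroupOf v.H
  let B : Subgroup Q := ((c.𝒜 v).subgroupOf v.H).map (QuotientGroup.mk' _)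
  have hBn : B.Normal := h3.map _ (QuotientGroup.mk'_surjective _)
  have hBc : ∀ a ∈ B, ∀ b ∈ B, a * b = b * a := by
    rintro _ ⟨x, hx, rfl⟩ _ ⟨y, hy, rfl⟩
    rw [QuotientGroup.mk'_apply, QuotientGroup.mk'_apply, ← QuotientGroup.mk_mul,
      ← QuotientGroup.mk_mul, QuotientGroup.eq, Subgroup.mem_subgroupOf]
    have := h4 y hy x hx
    have h5 : (((x * y)⁻¹ * (y * x) : v.H) : G) = (y : G)⁻¹ * (x : G)⁻¹ * y * x := by
      push_cast
      group
    rw [h5]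
    exact this
  have hM := hv.isAbelianNormalAbove_pullback (B := B ⊔ Subgroup.center Q) inferInstance
    (sup_center_commutative hBc)
  have hle : c.𝒜 v ≤ pullback (B ⊔ Subgroup.center Q) := by
    intro g hg
    refine mem_pullback.2 ⟨h2 hg, Subgroup.mem_sup_left ?_⟩
    exact ⟨⟨g, h2 hg⟩, hg, rfl⟩
  rw [Subgroup.eq_of_le_of_card_ge hle (c.card_le v hv _ hM)]
  exact hv.le_pullback_center.trans (pullback_le_pullback_iff.2 le_sup_right)

/-- The only use of the class `𝒞`. If `𝒜 = A`, every abelian normal subgroup of `H / ker ϑ`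
containing the center has preimage `A`. Then an abelian quotient gives `H = A`, while a noncentral
abelian normal `B`, joined with the center, would have preimage `A` and so be central. -/
theorem lt_𝒜 (hG : InClassC G) (hv : v.IsLinear) (hHA : v.H ≠ v.A) : v.A < c.𝒜 v := by
  refine lt_of_le_of_ne (c.le_𝒜 hv) fun heq => ?_
  have hn := hv.ker_normal
  let Q := v.H ⧸ hv.linear.ker.subgroupOf v.H
  have key : ∀ B : Subgroup Q, B.Normal → (∀ a ∈ B, ∀ b ∈ B, a * b = b * a) →
      pullback (Subgroup.center Q) ≤ pullback B → v.A = pullback B := by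
    intro B hB hc hle
    refine Subgroup.eq_of_le_of_card_ge (hv.le_pullback_center.trans hle) ?_
    conv_rhs => rw [heq]
    exact c.card_le v hv _ (hv.isAbelianNormalAbove_pullback hB hc)
  rcases hG v.H (hv.linear.ker.subgroupOf v.H) with hab | ⟨B, hB, hBc, hnc⟩
  · refine hHA (le_antisymm ?_ hv.1)
    rw [key ⊤ inferInstance (fun a _ b _ => hab a b) (pullback_le_pullback_iff.2 le_top)]
    exact fun g hg => mem_pullback.2 ⟨hg, Subgroup.mem_top _⟩
  · refine hnc ?_
    have h1 := key (B ⊔ Subgroup.center Q) inferInstance (sup_center_commutative hBc)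
      (pullback_le_pullback_iff.2 le_sup_right)
    have h2 := hv.le_pullback_center
    exact le_sup_left.trans (pullback_le_pullback_iff.1 (h1.symm.le.trans h2))

variable {c} {N : Subgroup G} {u w : Triple G}

theorem _root_.ShodaPairs.Triple.IsNLinear.fixer_idem (hv : v.IsNLinear N) :
    fixer (idem v.A v.ϑ) = N := by
  rw [← charKer_ind_top hv.1.linear, hv.2]

theorem Edge.ne (h : c.Edge N u w) : u.H ≠ u.A := h.2.2.1

theorem Edge.A_eq (h : c.Edge N u w) : w.A = c.𝒜 u := by
  obtain ⟨-, -, -, φ, -, rfl⟩ := h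
  rfl

theorem Edge.H_eq (h : c.Edge N u w) : w.H = inertia u.H w.ϑ := by
  obtain ⟨-, -, -, φ, -, rfl⟩ := h
  rfl

theorem Edge.mem_reps (h : c.Edge N u w) : w.ϑ ∈ c.reps u := by
  obtain ⟨-, -, -, φ, hφ, rfl⟩ := h
  exact hφ

theorem Edge.mem_linTilde (h : c.Edge N u w) : w.ϑ ∈ u.linTilde (c.𝒜 u) :=
  c.reps_subset u h.1.1 h.mem_reps

theorem Edge.eq_of_ϑ_eq {w' : Triple G} (h : c.Edge N u w) (h' : c.Edge N u w')
    (hϑ : w.ϑ = w'.ϑ) : w = w' := by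
  ext1
  · rw [h.H_eq, h'.H_eq, hϑ]
  · rw [h.A_eq, h'.A_eq]
  · exact hϑ

theorem Edge.A_le (h : c.Edge N u w) : w.A ≤ u.H := by
  rw [h.A_eq]
  exact (c.isAbelianNormalAbove u h.1.1).2.1

theorem Edge.le_normalizer (h : c.Edge N u w) : u.H ≤ Subgroup.normalizer (w.A : Set G) := by
  rw [h.A_eq]
  obtain ⟨-, h2, h3, -⟩ := c.isAbelianNormalAbove u h.1.1
  exact (Subgroup.normal_subgroupOf_iff_le_normalizer h2).1 h3

theorem Edge.isClifford (h : c.Edge N u w) : IsClifford u.H w.H (idem w.A w.ϑ) := by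
  rw [h.H_eq]
  exact isClifford_idem h.2.1.1.linear h.A_le h.le_normalizer

theorem Edge.idem_mul_idem (h : c.Edge N u w) :
    idem u.A u.ϑ * idem w.A w.ϑ = idem w.A w.ϑ := by
  refine idem_mul_idem_of_le h.1.1.linear h.2.1.1.linear ?_ h.mem_linTilde.2.1
  rw [h.A_eq]
  exact c.le_𝒜 h.1.1

theorem edge_of_mem_reps (hv : v.IsNLinear N) (hHA : v.H ≠ v.A) {φ : G → ℂ}
    (hφ : φ ∈ c.reps v) : c.Edge N v ⟨inertia v.H φ, c.𝒜 v, φ⟩ := by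
  obtain ⟨h1, h2, h3⟩ := c.reps_subset v hv.1 hφ
  obtain ⟨-, h5, h6, -⟩ := c.isAbelianNormalAbove v hv.1
  have hle : c.𝒜 v ≤ inertia v.H φ := le_inertia h1 h5
  refine ⟨hv, ⟨⟨hle, ?_, h1, fun x hx => hx.2⟩, ?_⟩, hHA, φ, hφ, rfl⟩
  · rw [Subgroup.normal_subgroupOf_iff_le_normalizer hle]
    exact (inertia_le _ _).trans ((Subgroup.normal_subgroupOf_iff_le_normalizer h5).1 h6)
  · exact h3.trans hv.2

open Relation

/-- The central idempotent of the character of `w.H` induced from the leaf `v`. -/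
noncomputable def nodeIdem (w v : Triple G) : MonoidAlgebra ℂ G :=
  trInd v.A w.H (idem v.A v.ϑ)

/-- The Clifford situations of the edges compose along the path. At the root this says that the
character of the leaf induces irreducibly to `G`. -/
theorem isClifford_of_reach (hv : v.IsLinear) (hHA : v.H = v.A)
    (h : ReflTransGen (c.Edge N) w v) :
    IsClifford w.H v.A (idem v.A v.ϑ) ∧ idem w.A w.ϑ * idem v.A v.ϑ = idem v.A v.ϑ := by
  induction h using ReflTransGen.head_induction_on with
  | refl =>
    refine ⟨⟨hv.1, idem_mem_cen hv.linear, ShodaPairs.idem_mul_idem hv.linear,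
      fun h hh hn => absurd (hHA ▸ hh) hn⟩, ShodaPairs.idem_mul_idem hv.linear⟩
  | head h1 _ ih =>
    refine ⟨h1.isClifford.trans ih.1 ?_, ?_⟩
    · rw [← cen_commute h1.isClifford.mem (supp_mono ih.1.le (idem_mem_supp hv.linear)), ih.2]
    · rw [← ih.2, ← mul_assoc, h1.idem_mul_idem]

section Leaf

variable (hv : v.IsNLinear N) (hHA : v.H = v.A)

include hv hHA

theorem isBlock_nodeIdem (h : ReflTransGen (c.Edge N) w v) : IsBlock w.H (nodeIdem w v) :=
  (isClifford_of_reach hv.1 hHA h).1.isBlock_trInd (isBlock_idem hv.1.linear)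
    (ShodaPairs.idem_mul_idem hv.1.linear)

theorem idem_mul_nodeIdem (hw : w.IsLinear) (h : ReflTransGen (c.Edge N) w v) :
    idem w.A w.ϑ * nodeIdem w v = nodeIdem w v := by
  rw [nodeIdem, mul_trInd, (isClifford_of_reach hv.1 hHA h).2]
  intro x hx
  rw [cj_idem]
  congr 1
  funext g
  exact hw.2.2.2 x hx g

/-- Descending one edge: the block of the leaf at the parent, cut by the idempotent of the child, is
its block at the child. -/
theorem nodeIdem_mul_idem (h1 : c.Edge N u w) (h : ReflTransGen (c.Edge N) w v) :
    nodeIdem u v * idem w.A w.ϑ = nodeIdem w v := by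
  have hb := isBlock_nodeIdem hv hHA h
  have h2 : nodeIdem u v = trInd w.H u.H (nodeIdem w v) := (trInd_trInd h1.isClifford.le _).symm
  rw [h2]
  refine h1.isClifford.trInd_mul_eq hb.mem ?_
  rw [← cen_commute h1.isClifford.mem hb.mem.1, idem_mul_nodeIdem hv hHA h1.2.1.1 h]

/-- Neither `trInd` nor a product can shrink `fixer`, and each of `nodeIdem w v` and the idempotent
of the leaf is obtained from the other by one of them. -/
theorem fixer_nodeIdem (h : ReflTransGen (c.Edge N) w v) : fixer (nodeIdem w v) = N := by
  rw [← hv.fixer_idem]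
  refine Set.Subset.antisymm ?_ (fixer_subset_trInd _)
  have h1 := (isClifford_of_reach hv.1 hHA h).1.trInd_mul_eq (idem_mem_cen hv.1.linear)
    (ShodaPairs.idem_mul_idem hv.1.linear)
  conv_rhs => rw [← h1]
  exact fixer_subset_mul _ _

end Leaf

/-- Completeness of the tree. A block over `ϑ` lies over some extension of `ϑ` to `𝒜`; after a
Galois twist this may be taken to be a chosen representative, and the Clifford correspondent is
again a block with kernel `N` over the next node. -/
theorem exists_leaf_of_isBlock (hG : InClassC G) (hv : v.IsNLinear N) {e : MonoidAlgebra ℂ G}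
    (he : IsBlock v.H e) (hve : idem v.A v.ϑ * e = e) (hN : fixer e = N) :
    ∃ u, ReflTransGen (c.Edge N) v u ∧ u.IsNLinear N ∧ u.H = u.A ∧
      ∃ σ : ℂ ≃+* ℂ, gal σ e = nodeIdem v u := by
  classical
  -- The measure decreases because `A` grows strictly along each edge.
  induction hn : Nat.card G - Nat.card v.A using Nat.strong_induction_on generalizing v e with
  | _ n ih =>
  by_cases hHA : v.H = v.A
  · refine ⟨v, .refl, hv, hHA, RingEquiv.refl ℂ, ?_⟩
    have hb : IsBlock v.H (idem v.A v.ϑ) := by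
      rw [hHA]
      exact isBlock_idem hv.1.linear
    have hb' := isBlock_nodeIdem (c := c) (w := v) hv hHA .refl
    have h1 := hb.eq_of_mul_ne_zero he (by rw [hve]; exact he.ne_zero)
    have h2 := hb.eq_of_mul_ne_zero hb' (by
      rw [idem_mul_nodeIdem (c := c) hv hHA hv.1 .refl]; exact hb'.ne_zero)
    rw [gal_refl, ← h1, h2]
  obtain ⟨-, hBH, hBn, hBc⟩ := c.isAbelianNormalAbove v hv.1
  have hAB := c.le_𝒜 hv.1
  have hlin := hv.1.linear
  have hnorm := (Subgroup.normal_subgroupOf_iff_le_normalizer hBH).1 hBn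
  have hkn : (hlin.ker.subgroupOf (c.𝒜 v)).Normal := by
    refine ⟨fun k hk x => ?_⟩
    rw [Subgroup.mem_subgroupOf, hlin.mem_ker] at hk ⊢
    rw [← hk]
    exact hv.1.2.2.2 x (hBH x.2) k
  have hsum := idem_eq_sum_extensions hlin hAB hkn hBc
  have hne := he.ne_zero
  rw [← hve, hsum, Finset.sum_mul] at hne
  obtain ⟨φ, hφ, hφe⟩ := Finset.exists_ne_zero_of_sum_ne_zero hne
  rw [Finset.mem_filter, mem_linChars] at hφ
  obtain ⟨hφl, hφr⟩ := hφ
  have hC := isClifford_idem hφl hBH hnorm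
  have hφe' : e * idem (c.𝒜 v) φ ≠ 0 := by
    rwa [cen_commute he.mem (supp_mono hC.le hC.mem.1)]
  -- The kernel of `φ ^ G` lies between that of `ϑ ^ G` and that of the character of `e` induced to
  -- `G`, and both of these are `N`.
  have hφN : fixer (idem (c.𝒜 v) φ) = N := by
    refine Set.Subset.antisymm ?_ ?_
    · rw [← hN]
      conv_rhs => rw [← hC.trInd_block_mul he hφe']
      rw [cen_commute he.mem (supp_mono hC.le hC.mem.1)]
      exact (fixer_subset_mul _ _).trans (fixer_subset_trInd _)
    · rw [← hv.fixer_idem]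
      conv_rhs => rw [← idem_mul_idem_of_le hlin hφl hAB hφr]
      exact fixer_subset_mul _ _
  obtain ⟨ψ, ⟨hψ, σ, hσ, h, hh, hψφ⟩, -⟩ := c.existsUnique_rep v hv.1 φ
    ⟨hφl, hφr, by rw [charKer_ind_top hφl, hφN, hv.2]⟩
  have hedge := edge_of_mem_reps hv hHA hψ
  set w : Triple G := ⟨inertia v.H ψ, c.𝒜 v, ψ⟩ with hw
  have hwC : IsClifford v.H w.H (idem w.A w.ϑ) := hedge.isClifford
  have hψ_eq : idem w.A w.ϑ = gal σ (cj h (idem (c.𝒜 v) φ)) := by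
    rw [cj_idem, gal_idem, ← funext hψφ]
  have he' := he.gal σ
  have he'ψ : gal σ e * idem w.A w.ϑ = gal σ (cj h (e * idem (c.𝒜 v) φ)) := by
    rw [hψ_eq, map_mul, map_mul, he.mem.2 h hh]
  have hne' : gal σ e * idem w.A w.ϑ ≠ 0 := by
    rw [he'ψ, Ne, map_eq_zero_iff _ (RingEquiv.injective _), map_eq_zero_iff _ (cj h).injective]
    exact hφe'
  have hb := hwC.isBlock_mul he' hne'
  have htr := hwC.trInd_block_mul he' hne'
  have hcard : Nat.card G - Nat.card w.A < n := by
    have h1 : Nat.card v.A < Nat.card w.A :=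
      Set.Finite.card_lt_card (Set.toFinite _) (c.lt_𝒜 hG hv.1 hHA)
    have h2 := Subgroup.card_le_card_group w.A
    omega
  obtain ⟨u, hu1, hu2, hu3, τ, hτ⟩ := ih _ hcard hedge.2.1 hb (by
      rw [cen_commute hwC.mem hb.mem.1, mul_assoc, hwC.idem]) (by
      refine Set.Subset.antisymm ?_ ?_
      · rw [← hN, ← fixer_gal σ e]
        conv_rhs => rw [← htr]
        exact fixer_subset_trInd _
      · rw [← hN, ← fixer_gal σ e]
        exact fixer_subset_mul _ _) rfl
  refine ⟨u, .head hedge hu1, hu2, hu3, σ.trans τ, ?_⟩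
  rw [← gal_gal, ← htr, gal_trInd, hτ]
  exact trInd_trInd hwC.le _

/-! ### Reachability, injective paths and leaves -/

section Paths

theorem reach_of_isPath {m : ℕ} {p : Fin (m + 1) → Triple G} (h : c.IsPath N m p v)
    (i : Fin (m + 1)) : ReflTransGen (c.Edge N) (p i) v := by
  induction i using Fin.reverseInduction with
  | last => rw [h.2.1]
  | cast i ih => exact .head (h.2.2.2 i) ih

theorem root_reach_of_isPath {m : ℕ} {p : Fin (m + 1) → Triple G} (h : c.IsPath N m p v)
    (i : Fin (m + 1)) : ReflTransGen (c.Edge N) (root N) (p i) := by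
  induction i using Fin.induction with
  | zero => rw [h.1]
  | succ i ih => exact .tail ih (h.2.2.2 i)

theorem exists_isPath (hG : InClassC G) (h : ReflTransGen (c.Edge N) (root N) v) :
    ∃ m p, c.IsPath N m p v := by
  have key : ∃ m, ∃ p : Fin (m + 1) → Triple G, p 0 = root N ∧ p (Fin.last m) = v ∧
      ∀ i : Fin m, c.Edge N (p i.castSucc) (p i.succ) := by
    induction h with
    | refl => exact ⟨0, fun _ => root N, rfl, rfl, fun i => i.elim0⟩
    | @tail u w _ huw ih =>
      obtain ⟨m, p, h0, h1, h2⟩ := ih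
      refine ⟨m + 1, Fin.snoc (α := fun _ => Triple G) p w, ?_, Fin.snoc_last _ _, fun i => ?_⟩
      · rw [← Fin.castSucc_zero, Fin.snoc_castSucc, h0]
      · induction i using Fin.lastCases with
        | last => rw [Fin.snoc_castSucc, Fin.succ_last, Fin.snoc_last, h1]; exact huw
        | cast i => rw [Fin.snoc_castSucc, Fin.succ_castSucc, Fin.snoc_castSucc]; exact h2 i
  obtain ⟨m, p, h0, h1, h2⟩ := key
  refine ⟨m, p, h0, h1, ?_, h2⟩
  have hmono : StrictMono fun i => (p i).A := Fin.strictMono_iff_lt_succ.2 fun i => by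
    have := c.lt_𝒜 hG (h2 i).1.1 (h2 i).ne
    rwa [← (h2 i).A_eq] at this
  intro i j hij
  exact hmono.injective (congrArg Triple.A hij)

theorem root_isNLinear (hN : N.Normal) : (root N).IsNLinear N := by
  have h1 : IsLinearCharacter N (triv N) := isLinearCharacter_triv N
  have h2 : ∀ g, triv N g = 1 ↔ g ∈ N := fun g => by
    rw [← h1.mem_charKer, charKer_triv]
    rfl
  refine ⟨⟨le_top, hN.subgroupOf _, h1, fun x _ g => ?_⟩, ?_⟩
  · change triv N (x * g * x⁻¹) = triv N g
    by_cases hg : g ∈ N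
    · rw [(h2 g).2 hg, h2]
      exact hN.conj_mem g hg x
    · rw [h1.eq_zero hg, h1.eq_zero]
      intro h
      exact hg (by simpa [mul_assoc] using hN.conj_mem _ h x⁻¹)
  · change charKer (ind N ⊤ (triv N)) = N
    rw [charKer_ind_top h1]
    ext g
    rw [mem_fixer_idem h1]
    simp only [h2]
    exact ⟨fun h => by simpa using h 1, fun h x => hN.conj_mem g h x⟩

/-- A node with `H = A` has no outgoing edge, so being a sink is automatic, and so is injectivity of
paths because `A` grows strictly. -/
theorem mem_leaves_iff (hG : InClassC G) :
    v ∈ c.leaves N ↔ ReflTransGen (c.Edge N) (root N) v ∧ v.IsNLinear N ∧ v.H = v.A := by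
  constructor
  · rintro ⟨⟨h1, m, p, hp⟩, -, h2⟩
    have := root_reach_of_isPath hp (Fin.last m)
    rw [hp.2.1] at this
    exact ⟨this, h1, h2⟩
  · rintro ⟨h1, h2, h3⟩
    exact ⟨⟨h2, exists_isPath hG h1⟩, fun u _ h => h.ne h3, h3⟩

end Paths

end Choices

end ShodaPairs

/-! ### Goodness of leaves against injectivity of the realization map -/

namespace ShodaPairs

variable {G : Type*} [Group G] [Fintype G]

/-- Clifford's theorem: `e` is the trace of `e * idem B φ`, so some `H`-conjugate of `idem B φ` is
not orthogonal to `idem B φ'`, and non-orthogonal means equal. -/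
theorem exists_conj_of_isBlock {H B : Subgroup G} {φ φ' : G → ℂ} (hBH : B ≤ H)
    (hn : H ≤ Subgroup.normalizer (B : Set G)) (hφ : IsLinearCharacter B φ)
    (hφ' : IsLinearCharacter B φ') {e : MonoidAlgebra ℂ G} (he : IsBlock H e)
    (h : e * idem B φ ≠ 0) (h' : e * idem B φ' ≠ 0) :
    ∃ x ∈ H, ∀ g, φ' g = φ (x * g * x⁻¹) := by
  classical
  have hC := isClifford_idem hφ hBH hn
  rw [← hC.trInd_block_mul he h, ← mul_trInd he.mem.2, mul_assoc, trInd_apply, smul_mul_assoc,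
    Finset.sum_mul, mul_smul_comm, Finset.mul_sum] at h'
  obtain ⟨x, hx, hne⟩ := Finset.exists_ne_zero_of_sum_ne_zero (right_ne_zero_of_smul h')
  have hxH : x ∈ H := by simpa using hx
  refine ⟨x, hxH, fun g => ?_⟩
  by_contra hg
  refine hne ?_
  rw [cj_idem, idem_mul_idem_of_ne (hφ.conj_normalizer (hn hxH)) hφ', mul_zero]
  rintro rfl
  exact hg rfl

theorem trInd_cj {T H : Subgroup G} {x : G} (hx : x ∈ H) (f : MonoidAlgebra ℂ G) :
    trInd T H (cj x f) = trInd T H f := by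
  classical
  rw [trInd_apply, trInd_apply]
  congr 1
  refine Finset.sum_bij' (fun y _ => x * y) (fun y _ => x⁻¹ * y) ?_ ?_ ?_ ?_ ?_
  · intro y hy
    simpa [H.mul_mem_cancel_left hx] using hy
  · intro y hy
    simpa [H.mul_mem_cancel_left (H.inv_mem hx)] using hy
  · simp
  · simp
  · intro y _
    rw [cj_cj]

theorem ringEquiv_apply_of_mem_adjoin {s : Set ℂ} {σ : ℂ ≃+* ℂ} (h : ∀ z ∈ s, σ z = z) :
    ∀ z ∈ IntermediateField.adjoin ℚ s, σ z = z := by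
  intro z hz
  induction hz using IntermediateField.adjoin_induction with
  | mem x hx => exact h x hx
  | algebraMap q => simp
  | add x y _ _ hx hy => rw [map_add, hx, hy]
  | inv x _ hx => rw [map_inv₀, hx]
  | mul x y _ _ hx hy => rw [map_mul, hx, hy]

/-- The normal subgroup of the elements of `G` that fix all conjugates of `e`. -/
def fixerSubgroup (e : MonoidAlgebra ℂ G) : Subgroup G where
  carrier := fixer e
  one_mem' := fun x => by rw [map_one, one_mul]
  mul_mem' := fun {a b} ha hb x => by rw [map_mul, mul_assoc, hb x, ha x]
  inv_mem' := fun {a} ha x => by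
    conv_lhs => rw [← ha x]
    rw [← mul_assoc, ← map_mul, inv_mul_cancel, map_one, one_mul]

omit [Fintype G] in
theorem fixerSubgroup_normal (e : MonoidAlgebra ℂ G) : (fixerSubgroup e).Normal := by
  refine ⟨fun n hn g x => ?_⟩
  have h1 : MonoidAlgebra.of ℂ G n * cj (x * g) e = cj (x * g) e := hn _
  have h2 : cj x e = cj g⁻¹ (cj (x * g) e) := by
    rw [cj_cj, mul_inv_cancel_right]
  rw [h2]
  conv_rhs => rw [← h1]
  rw [map_mul (cj g⁻¹), cj_of, inv_inv]

namespace Choices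

open Relation

variable {c : Choices G} {N : Subgroup G} {v : Triple G}

theorem isShodaPair_of_reach (hv : v.IsNLinear N) (hHA : v.H = v.A)
    (h : ReflTransGen (c.Edge N) (root N) v) {K : Subgroup G} (hK : (K : Set G) = charKer v.ϑ) :
    IsShodaPair (v.A, K) :=
  (isShodaPair_iff hv.1.linear hK.symm).2 (isClifford_of_reach hv.1 hHA h).1

/-- The inductive step for irredundancy: the unique choice of representatives identifies the
children, and goodness carries Galois conjugacy of the two blocks down to the common child. -/
theorem edge_eq_and_exists_gal {x a b u : Triple G} (hu : u.IsNLinear N) (hu' : u.H = u.A)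
    (hv : v.IsNLinear N) (hv' : v.H = v.A) (hxa : c.Edge N x a) (hxb : c.Edge N x b)
    (hau : ReflTransGen (c.Edge N) a u) (hbv : ReflTransGen (c.Edge N) b v)
    {τ : ℂ ≃+* ℂ} (hτ : gal τ (nodeIdem x u) = nodeIdem x v)
    (hgood : ∀ y ∈ x.H, y ∈ Subgroup.normalizer (charKer b.ϑ) → ∃ σ : ℂ ≃+* ℂ, ∀ g,
      ind v.A b.H v.ϑ (y * g * y⁻¹) = σ (ind v.A b.H v.ϑ g)) :
    a = b ∧ ∃ τ' : ℂ ≃+* ℂ, gal τ' (nodeIdem a u) = nodeIdem b v := by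
  have hxu := ReflTransGen.head hxa hau
  have hxv := ReflTransGen.head hxb hbv
  have hx := hxa.1.1
  have hE := isBlock_nodeIdem hv hv' hxv
  have h1 := idem_mul_nodeIdem hv hv' hx hxv
  -- Otherwise two orthogonal idempotents would both fix the nonzero block `nodeIdem x v`. Hence `τ`
  -- fixes `ℚ(x.ϑ)` and is admissible in the double action.
  have hfix : (fun g => τ (x.ϑ g)) = x.ϑ := by
    by_contra hne
    have h2 := congrArg (gal τ) (idem_mul_nodeIdem hu hu' hx hxu)
    rw [map_mul, gal_idem, hτ, ← h1, ← mul_assoc,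
      ShodaPairs.idem_mul_idem_of_ne (hx.linear.comp_ringEquiv τ) hx.linear hne, zero_mul, h1] at h2
    exact hE.ne_zero h2.symm
  have hAa : a.A = b.A := hxa.A_eq.trans hxb.A_eq.symm
  have hal : IsLinearCharacter b.A a.ϑ := hAa ▸ hxa.2.1.1.linear
  have h3 : nodeIdem x v * idem b.A (fun g => τ (a.ϑ g)) = gal τ (nodeIdem a u) := by
    rw [← nodeIdem_mul_idem hu hu' hxa hau, map_mul, hτ, gal_idem, hAa]
  have h4 : nodeIdem x v * idem b.A b.ϑ = nodeIdem b v := nodeIdem_mul_idem hv hv' hxb hbv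
  obtain ⟨h, hh, hconj⟩ := exists_conj_of_isBlock hxb.A_le hxb.le_normalizer
    (hal.comp_ringEquiv τ) hxb.2.1.1.linear hE
    (by rw [h3]; exact ((isBlock_nodeIdem hu hu' hau).gal τ).ne_zero)
    (by rw [h4]; exact (isBlock_nodeIdem hv hv' hbv).ne_zero)
  have hϑ : a.ϑ = b.ϑ := by
    refine (c.existsUnique_rep x hx a.ϑ hxa.mem_linTilde).unique
      ⟨hxa.mem_reps, RingEquiv.refl ℂ, fun _ _ => rfl, 1, x.H.one_mem, fun g => by simp⟩
      ⟨hxb.mem_reps, τ, ringEquiv_apply_of_mem_adjoin ?_, h, hh, hconj⟩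
    rintro _ ⟨g, rfl⟩
    exact congrFun hfix g
  have hab := hxa.eq_of_ϑ_eq hxb hϑ
  subst hab
  refine ⟨rfl, ?_⟩
  -- After the identification, `h` carries `a.ϑ` to a Galois conjugate of itself, which has the same
  -- kernel.
  have hnorm : h ∈ Subgroup.normalizer (charKer a.ϑ) := by
    rw [← hal.coe_ker, Subgroup.mem_normalizer_iff]
    intro g
    rw [hal.mem_ker, hal.mem_ker, hconj, map_eq_one_iff τ τ.injective]
  obtain ⟨σ, hσ⟩ := hgood h⁻¹ (x.H.inv_mem hh) (inv_mem hnorm)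
  have h5 : cj h⁻¹ (nodeIdem a v) = gal σ (nodeIdem a v) := (cj_trInd_idem_eq_gal_iff _ _).2 hσ
  have h6 : cj h (gal τ (nodeIdem a u)) = nodeIdem a v := by
    rw [← h3, map_mul, hE.mem.2 h hh, cj_idem, ← h4]
    congr 2
    exact (funext hconj).symm
  refine ⟨τ.trans σ.symm, ?_⟩
  rw [← gal_gal, ← gal_symm_gal σ (nodeIdem a v), ← h5, ← h6, cj_cj, mul_inv_cancel, cj_one]

theorem eq_of_isGood {u : Triple G} (hu : u ∈ c.leaves N) (hv : v ∈ c.leaves N)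
    (hgood : c.IsGood N v) {τ : ℂ ≃+* ℂ}
    (hτ : gal τ (nodeIdem (root N) u) = nodeIdem (root N) v) : u = v := by
  obtain ⟨⟨hul, m, p, hp⟩, -, hu'⟩ := hu
  obtain ⟨⟨hvl, -⟩, -, hv'⟩ := hv
  obtain ⟨n, q, hq, hgood⟩ := hgood
  have key : ∀ k (hkm : k < m + 1) (hkn : k < n + 1), p ⟨k, hkm⟩ = q ⟨k, hkn⟩ ∧
      ∃ τ : ℂ ≃+* ℂ, gal τ (nodeIdem (p ⟨k, hkm⟩) u) = nodeIdem (q ⟨k, hkn⟩) v := by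
    intro k
    induction k with
    | zero =>
      intro hkm hkn
      have h1 : p ⟨0, hkm⟩ = root N := hp.1
      have h2 : q ⟨0, hkn⟩ = root N := hq.1
      rw [h1, h2]
      exact ⟨rfl, τ, hτ⟩
    | succ k ih =>
      intro hkm hkn
      obtain ⟨h1, τ, h2⟩ := ih (by omega) (by omega)
      have hpe : c.Edge N (p ⟨k, by omega⟩) (p ⟨k + 1, hkm⟩) := hp.2.2.2 ⟨k, by omega⟩
      have hqe : c.Edge N (q ⟨k, by omega⟩) (q ⟨k + 1, hkn⟩) := hq.2.2.2 ⟨k, by omega⟩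
      rw [h1] at hpe h2
      exact edge_eq_and_exists_gal hul hu' hvl hv' hpe hqe (reach_of_isPath hp _)
        (reach_of_isPath hq _) h2 (hgood ⟨k, by omega⟩)
  -- Paths of different lengths are impossible: the shorter one would end at a leaf from which the
  -- longer one continues.
  rcases lt_trichotomy m n with hmn | rfl | hmn
  · have h1 : p (Fin.last m) = q ⟨m, by omega⟩ := (key m (by omega) (by omega)).1
    have hqe : c.Edge N (q ⟨m, by omega⟩) (q ⟨m + 1, by omega⟩) := hq.2.2.2 ⟨m, hmn⟩
    rw [← h1, hp.2.1] at hqe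
    exact absurd hu' hqe.ne
  · rw [← hp.2.1, ← hq.2.1]
    exact (key m (by omega) (by omega)).1
  · have h1 : p ⟨n, by omega⟩ = q (Fin.last n) := (key n (by omega) (by omega)).1
    have hpe : c.Edge N (p ⟨n, by omega⟩) (p ⟨n + 1, by omega⟩) := hp.2.2.2 ⟨n, hmn⟩
    rw [h1, hq.2.1] at hpe
    exact absurd hv' hpe.ne

/-- As `x` preserves `ker b.ϑ`, conjugation by `x` changes `b.ϑ` only by a field automorphism.
Undoing that twist puts the conjugated block back over `b.ϑ`, where completeness supplies a leaf. -/
theorem exists_leaf_of_edge (hG : InClassC G) {a b : Triple G} (hv : v.IsNLinear N)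
    (hv' : v.H = v.A) (hab : c.Edge N a b) (hbv : ReflTransGen (c.Edge N) b v) {x : G}
    (hx : x ∈ a.H) (hxn : x ∈ Subgroup.normalizer (charKer b.ϑ)) :
    ∃ u, ReflTransGen (c.Edge N) b u ∧ u.IsNLinear N ∧ u.H = u.A ∧
      ∃ σ : ℂ ≃+* ℂ, gal σ (cj x (nodeIdem b v)) = nodeIdem b u := by
  have hb := hab.2.1.1.linear
  have hbx := hb.conj_normalizer (hab.le_normalizer hx)
  have hker : charKer b.ϑ = charKer (fun g => b.ϑ (x * g * x⁻¹)) := by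
    rw [← hb.coe_ker] at hxn
    ext g
    rw [hb.mem_charKer, hbx.mem_charKer, ← hb.mem_ker, Subgroup.mem_normalizer_iff.1 hxn g,
      hb.mem_ker]
  obtain ⟨σ, hσ⟩ := hb.exists_ringEquiv_of_charKer_eq hbx hker
  have hE := isBlock_nodeIdem hv hv' (.head hab hbv)
  have hnb := isBlock_nodeIdem hv hv' hbv
  have h1 : gal σ.symm (cj x (nodeIdem b v)) =
      gal σ.symm (nodeIdem a v) * idem b.A b.ϑ := by
    rw [← nodeIdem_mul_idem hv hv' hab hbv, map_mul, map_mul, hE.mem.2 x hx, cj_idem, funext hσ,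
      ← gal_idem, gal_symm_gal]
  have hne : gal σ.symm (nodeIdem a v) * idem b.A b.ϑ ≠ 0 := by
    rw [← h1, Ne, map_eq_zero_iff _ (RingEquiv.injective _), map_eq_zero_iff _ (cj x).injective]
    exact hnb.ne_zero
  have hC := hab.isClifford
  have hblock := hC.isBlock_mul (hE.gal σ.symm) hne
  obtain ⟨u, hu1, hu2, hu3, τ, hτ⟩ := exists_leaf_of_isBlock (c := c) hG hab.2.1 hblock (by
      rw [cen_commute hC.mem hblock.mem.1, mul_assoc, hC.idem]) (by
      rw [← h1, fixer_gal, fixer_cj, fixer_nodeIdem hv hv' hbv])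
  refine ⟨u, hu1, hu2, hu3, σ.symm.trans τ, ?_⟩
  rw [← gal_gal, h1, hτ]

theorem mem_iUnion_shodaPairs (hG : InClassC G) {p : Subgroup G × Subgroup G} :
    p ∈ (⋃ N ∈ {N : Subgroup G | N.Normal}, c.shodaPairs N) ↔
      ∃ N : Subgroup G, N.Normal ∧ ∃ v : Triple G, ReflTransGen (c.Edge N) (root N) v ∧
        v.IsNLinear N ∧ v.H = v.A ∧ ∃ K : Subgroup G, (K : Set G) = charKer v.ϑ ∧
          p = (v.A, K) := by
  simp only [Set.mem_iUnion, Set.mem_ofPred_eq, shodaPairs, mem_leaves_iff hG]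
  constructor
  · rintro ⟨N, hN, v, ⟨h1, h2, h3⟩, h4, h5⟩
    exact ⟨N, hN, v, h1, h2, h3, p.2, h5, Prod.ext (h4.trans h3) rfl⟩
  · rintro ⟨N, hN, v, h1, h2, h3, K, h4, rfl⟩
    exact ⟨N, hN, v, ⟨h1, h2, h3⟩, h3.symm, h4⟩

theorem isGood_of_injOn (hG : InClassC G) (hN : N.Normal) (hv : v ∈ c.leaves N)
    (hinj : Set.InjOn realized (⋃ N ∈ {N : Subgroup G | N.Normal}, c.shodaPairs N)) :
    c.IsGood N v := by
  obtain ⟨hrv, hvl, hv'⟩ := (mem_leaves_iff hG).1 hv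
  obtain ⟨m, p, hp⟩ := hv.1.2
  refine ⟨m, p, hp, fun i x hx hxn => ?_⟩
  have hab := hp.2.2.2 i
  have hbv := reach_of_isPath hp i.succ
  have hrb := root_reach_of_isPath hp i.succ
  have hra := root_reach_of_isPath hp i.castSucc
  obtain ⟨u, hbu, hul, hu', σ, hσ⟩ := exists_leaf_of_edge hG hvl hv' hab hbv hx hxn
  have hru := hrb.trans hbu
  have hSv := isShodaPair_of_reach hvl hv' hrv hvl.1.linear.coe_ker
  have hSu := isShodaPair_of_reach hul hu' hru hul.1.linear.coe_ker
  have htrans : ∀ w : Triple G, trInd (p i.succ).H ⊤ (nodeIdem (p i.succ) w) =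
      indIdem w.A w.ϑ := fun w => trInd_trInd le_top _
  -- Conjugation by `x` becomes invisible after inducing to `G`, so both leaves realize the same
  -- idempotent.
  have hgal : gal σ (indIdem v.A v.ϑ) = indIdem u.A u.ϑ := by
    rw [← htrans u, ← hσ, ← gal_trInd, trInd_cj (Subgroup.mem_top x), htrans]
  have hpv := (mem_iUnion_shodaPairs (c := c) hG).2
    ⟨N, hN, v, hrv, hvl, hv', hvl.1.linear.ker, hvl.1.linear.coe_ker, rfl⟩
  have hpu := (mem_iUnion_shodaPairs (c := c) hG).2
    ⟨N, hN, u, hru, hul, hu', hul.1.linear.ker, hul.1.linear.coe_ker, rfl⟩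
  have heq : (v.A, hvl.1.linear.ker) = (u.A, hul.1.linear.ker) := hinj hpv hpu
    ((realized_eq_iff hSv hvl.1.linear hvl.1.linear.coe_ker.symm hSu hul.1.linear
      hul.1.linear.coe_ker.symm).2 ⟨σ, hgal⟩)
  obtain ⟨hA, hK⟩ := Prod.mk.inj heq
  rw [← SetLike.coe_set_eq, hvl.1.linear.coe_ker, hul.1.linear.coe_ker] at hK
  have hvl' : IsLinearCharacter u.A v.ϑ := by
    rw [← hA]
    exact hvl.1.linear
  -- The pairs coincide, so the two leaf characters are linear characters of one subgroup with one
  -- kernel, hence Galois conjugate. Combined with `σ` this makes the `x`-conjugate of the block of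
  -- `v` a Galois conjugate of it.
  obtain ⟨ρ, hρ⟩ := hul.1.linear.exists_ringEquiv_of_charKer_eq hvl' hK.symm
  have h1 : gal ρ (nodeIdem (p i.succ) u) = nodeIdem (p i.succ) v := by
    rw [nodeIdem, nodeIdem, gal_trInd, gal_idem, hA, funext hρ]
  have h2 : gal (σ.trans ρ) (cj x (nodeIdem (p i.succ) v)) = nodeIdem (p i.succ) v := by
    rw [← gal_gal, hσ, h1]
  exact ⟨(σ.trans ρ).symm, (cj_trInd_idem_eq_gal_iff x _).1
    ((gal_symm_gal _ _).symm.trans (congrArg (gal (σ.trans ρ).symm) h2))⟩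

theorem injOn_of_forall_isGood (hG : InClassC G)
    (hgood : ∀ N : Subgroup G, N.Normal → ∀ v ∈ c.leaves N, c.IsGood N v) :
    Set.InjOn realized (⋃ N ∈ {N : Subgroup G | N.Normal}, c.shodaPairs N) := by
  intro r hr s hs heq
  obtain ⟨N, hN, u, hru, hul, hu', K, hK, rfl⟩ := (mem_iUnion_shodaPairs hG).1 hr
  obtain ⟨M, hM, v, hrv, hvl, hv', L, hL, rfl⟩ := (mem_iUnion_shodaPairs hG).1 hs
  obtain ⟨σ, hσ⟩ := (realized_eq_iff (isShodaPair_of_reach hul hu' hru hK) hul.1.linear hK.symm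
    (isShodaPair_of_reach hvl hv' hrv hL) hvl.1.linear hL.symm).1 heq
  -- The kernel of the induced character is a Galois invariant of its block, so leaves of different
  -- trees never realize the same idempotent.
  have hNM : N = M := by
    apply SetLike.coe_injective
    rw [← fixer_nodeIdem hul hu' hru, ← fixer_nodeIdem hvl hv' hrv]
    change fixer (indIdem u.A u.ϑ) = fixer (indIdem v.A v.ϑ)
    rw [← hσ, fixer_gal]
  subst hNM
  have hv := (mem_leaves_iff hG).2 ⟨hrv, hvl, hv'⟩
  have huv : u = v := eq_of_isGood ((mem_leaves_iff hG).2 ⟨hru, hul, hu'⟩) hv (hgood N hN v hv) hσ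
  subst huv
  rw [SetLike.coe_injective (hK.trans hL.symm)]

theorem exists_realized_eq (hG : InClassC G) {p : Subgroup G × Subgroup G} (hp : IsShodaPair p) :
    ∃ q ∈ (⋃ N ∈ {N : Subgroup G | N.Normal}, c.shodaPairs N), realized q = realized p := by
  obtain ⟨H, K⟩ := p
  obtain ⟨hKH, ⟨hKn, hcyc⟩, -⟩ := id hp
  obtain ⟨ϑ, hϑ, hK⟩ := exists_linearCharacter_of_isCyclic hKH hKn hcyc
  have hE := isBlock_indIdem hϑ ((isShodaPair_iff hϑ hK).1 hp)
  -- The tree to search is that of the kernel of `ϑ ^ G`; its root condition says only that this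
  -- kernel fixes the block.
  set N := fixerSubgroup (indIdem H ϑ) with hNdef
  have hN : N.Normal := fixerSubgroup_normal _
  obtain ⟨u, hru, hul, hu', σ, hσ⟩ := exists_leaf_of_isBlock (c := c) (v := root N) hG
    (root_isNLinear hN) hE (idem_mul_eq_self (isLinearCharacter_triv N) fun a ha => by
      rw [triv_apply_mem ha, one_smul]
      have h1 := (show a ∈ fixer (indIdem H ϑ) from ha) 1
      rwa [cj_one] at h1) rfl
  refine ⟨(u.A, hul.1.linear.ker), (mem_iUnion_shodaPairs hG).2
    ⟨N, hN, u, hru, hul, hu', _, rfl, rfl⟩, ?_⟩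
  exact ((realized_eq_iff hp hϑ hK (isShodaPair_of_reach hul hu' hru hul.1.linear.coe_ker)
    hul.1.linear hul.1.linear.coe_ker.symm).2 ⟨σ, hσ⟩).symm

end Choices

end ShodaPairs

theorem theorem4p6 {G : Type*} [Group G] [Fintype G] (hG : ShodaPairs.InClassC G)
    (c : ShodaPairs.Choices G) :
    ShodaPairs.IsCompleteIrredundant (⋃ N ∈ {N : Subgroup G | N.Normal}, c.shodaPairs N) ↔
      ∀ N : Subgroup G, N.Normal → ∀ v ∈ c.leaves N, c.IsGood N v := by
  constructor
  · intro h N hN v hv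
    exact ShodaPairs.Choices.isGood_of_injOn hG hN hv h.2.injOn
  · intro hgood
    have hS : ∀ p ∈ (⋃ N ∈ {N : Subgroup G | N.Normal}, c.shodaPairs N),
        ShodaPairs.IsShodaPair p ∧ ShodaPairs.IsPrimitiveCentralIdempotent
          (ShodaPairs.realized p) := by
      intro p hp
      obtain ⟨N, -, v, hrv, hvl, hv', K, hK, rfl⟩ :=
        (ShodaPairs.Choices.mem_iUnion_shodaPairs hG).1 hp
      have h1 := ShodaPairs.Choices.isShodaPair_of_reach hvl hv' hrv hK
      exact ⟨h1, ShodaPairs.isPrimitiveCentralIdempotent_realized h1 hvl.1.linear hK.symm⟩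
    refine ⟨fun p hp => (hS p hp).1, fun p hp => ⟨(hS p hp).2, p, (hS p hp).1, rfl⟩,
      ShodaPairs.Choices.injOn_of_forall_isGood hG hgood, ?_⟩
    rintro _ ⟨-, p, hp, rfl⟩
    exact ShodaPairs.Choices.exists_realized_eq hG hp
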